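/- **Setting.** Let $\Sigma=\{1,\dots,d\}$, $T>0$, $0<\kappa\le M$, $A=[\kappa,M]^d$, and let $P(\Sigma)\subset\mathbb R^d$ be the simplex of probability vectors; $|\cdot|$ is the Euclidean norm. Let $F,G:\Sigma\times P(\Sigma)\to\mathbb R$ and $L:\Sigma\times A\to\mathbb R$, with $L$ continuous in the control, and assume that for all $x\in\Sigma$, $p\in\mathbb R^d$ the function $a\mapsto L(x,a)+a\cdot p$ has a unique minimizer $\alpha^*(x,p)$ in $A$. Put $H(x,p)=\sup_{a\in A}\{-a\cdot p-L(x,a)\}$. For $g:\Sigma\to\mathbb R$ let $\Delta g(x)=(g(y)-g(x))_{y\in\Sigma}$; for $g:\Sigma^N\to\mathbb R$ let $\Delta^jg(\boldsymbol x)\in\mathbb R^d$ be the same difference in the $j$-th coordinate. For $\boldsymbol x\in\Sigma^N$ let $m^N_{\boldsymbol x}=\frac1N\sum_j\delta_{x_j}$ and $m^{N,i}_{\boldsymbol x}=\frac1{N-1}\sum_{j\ne i}\delta_{x_j}$. For $\Phi:P(\Sigma)\to\mathbb R$, a function $D^m\Phi:P(\Sigma)\times\Sigma\to\mathbb R^d$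 is a derivative of $\Phi$ if $[D^m\Phi(m,y)]_z=\lim_{s\to0^+}\frac{\Phi(m+s(\delta_z-\delta_y))-\Phi(m)}{s}$ whenever the direction $\delta_z-\delta_y$ is admissible at $m$ (i.e. does not immediately leave the simplex). A function $U:[0,T]\times\Sigma\times P(\Sigma)\to\mathbb R$ is a *regular solution* of the Master Equation if it is continuous, $C^1$ in $t$, and has a derivative $D^mU(t,x,m,y)$ with respect to $m$ that is Lipschitz continuous in $m$ uniformly in $(t,x,y)$, such that for all $(t,x,m)$ $$-\partial_tU+H(x,\Delta^xU)-\sum_{y\in\Sigma}m_y\,D^mU(t,x,m,y)\cdot\alpha^*(y,\Delta^yU(t,y,m))=F(x,m),\qquad U(T,x,m)=G(x,m).$$ **Assumptions.** There is a regular solution $U$, and (H1) holds: $H(x,\cdot)$ and $\alpha^*(x,\cdot)$ are Lipschitz continuous on $\{|p|\le K\}$ for every $x\in\Sigma$, where $K$ is at least the a priori bound $2\sqrt d\,\big(T(\max_x|H(x,0)|+\sup|F|)+\sup|G|\big)$ for the finite differences of the value functions. For $N\ge2$ let $v^{N,i}:[0,T]\times\Sigma^N\to\mathbb R$, $i=1,\dots,N$,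 be the ($C^1$ in time) solution of $$-\partial_tv^{N,i}-\sum_{j\ne i}\alpha^*(x_j,\Delta^jv^{N,j})\cdot\Delta^jv^{N,i}+H(x_i,\Delta^iv^{N,i})=F(x_i,m^{N,i}_{\boldsymbol x}),\qquad v^{N,i}(T,\boldsymbol x)=G(x_i,m^{N,i}_{\boldsymbol x}),$$ and let $u^{N,i}(t,\boldsymbol x)=U(t,x_i,m^{N,i}_{\boldsymbol x})$. Let $\Xi=[0,M]^d$ and let $\nu$ be the sum of the one-dimensional Lebesgue measures on the $d$ coordinate axes intersected with $\Xi$. On a filtered probability space let $\mathcal N_1,\dots,\mathcal N_N$ be independent Poisson random measures on $[0,T]\times\Xi$ with intensity $dt\otimes\nu$, Poisson with respect to the filtration, and let $Z_1,\dots,Z_N$ be i.i.d. $\Sigma$-valued, $\mathcal F_0$-measurable (hence independent of the noise) with law $m_0\in P(\Sigma)$. Let $\boldsymbol Y$ and $\boldsymbol X$ be adapted càdlàg $\Sigma^N$-valued solutions on $[0,T]$ of $$Y_i(t)=Z_i+\int_0^t\!\!\int_\Xi\sum_{y\in\Sigma}(y-Y_i(s^-))\mathbf 1_{]0,\alpha^i_y(s,\boldsymbol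 Y_{s^-})[}(\xi_y)\,\mathcal N_i(ds,d\xi),$$ $$X_i(t)=Z_i+\int_0^t\!\!\int_\Xi\sum_{y\in\Sigma}(y-X_i(s^-))\mathbf 1_{]0,\tilde\alpha^i_y(s,\boldsymbol X_{s^-})[}(\xi_y)\,\mathcal N_i(ds,d\xi),$$ where $\alpha^i(t,\boldsymbol x)=\alpha^*(x_i,\Delta^iv^{N,i}(t,\boldsymbol x))$ and $\tilde\alpha^i(t,\boldsymbol x)=\alpha^*(x_i,\Delta^iu^{N,i}(t,\boldsymbol x))$. **Theorem.** There is a constant $C>0$, independent of $N$, $i$, $m_0$, of the probability space, the noise and the initial data, such that for every $N\ge2$ and every $i\in\{1,\dots,N\}$ $$\mathbb E\Big[\sup_{t\in[0,T]}|Y_i(t)-X_i(t)|\Big]\le\frac CN,\qquad \mathbb E\Big[\sup_{t\in[0,T]}|m^N_{\boldsymbol Y_t}-m^N_{\boldsymbol X_t}|\Big]\le\frac CN,$$ $$\mathbb E\Big[\sup_{t\in[0,T]}|u^{N,i}(t,\boldsymbol Y_t)-v^{N,i}(t,\boldsymbol Y_t)|^2+\int_0^T|\Delta^iu^{N,i}(t,\boldsymbol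 Y_t)-\Delta^iv^{N,i}(t,\boldsymbol Y_t)|^2dt\Big]\le\frac C{N^2},$$ $$\frac1N\sum_{i=1}^N|v^{N,i}(0,\boldsymbol Z)-u^{N,i}(0,\boldsymbol Z)|\le\frac CN\qquad\text{almost surely}.$$ -/

import Mathlib

open Set Filter Topology MeasureTheory ProbabilityTheory
open scoped NNReal ENNReal BigOperators

noncomputable section

namespace FiniteMFG

/-- `ℝ^d` with its Euclidean norm: costates, controls, marks and measures on the state space
`Fin d` (the states `1, …, d`) all live here. -/
abbrev Vec (d : ℕ) : Type := EuclideanSpace ℝ (Fin d)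

/-- The numerical value `1, …, d` of a state. -/
def label {d : ℕ} (x : Fin d) : ℝ := ((x : ℕ) : ℝ) + 1

/-- The Dirac mass at the state `x`. -/
def diracVec {d : ℕ} (x : Fin d) : Vec d := EuclideanSpace.single x (1 : ℝ)

/-- The simplex `P(Σ)` of probability vectors. -/
def simplex (d : ℕ) : Set (Vec d) := {m | (∀ x, 0 ≤ m x) ∧ ∑ x, m x = 1}

/-- The set `[κ, M]^d` of control values. -/
def controlSet (d : ℕ) (κ M : ℝ) : Set (Vec d) := {a | ∀ y, a y ∈ Icc κ M}

/-- The finite difference `Δ g (x) = (g y - g x)_y` of a function on the state space. -/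
def stateDiff {d : ℕ} (g : Fin d → ℝ) (x : Fin d) : Vec d :=
  WithLp.toLp 2 fun y => g y - g x

/-- The finite difference `Δ^j g (x)` of a function of `N` states with respect to the state of
the `j`-th player. -/
def playerDiff {d N : ℕ} (j : Fin N) (g : (Fin N → Fin d) → ℝ) (x : Fin N → Fin d) : Vec d :=
  WithLp.toLp 2 fun y => g (Function.update x j y) - g x

/-- The empirical measure of all players. -/
def empirical {d N : ℕ} (x : Fin N → Fin d) : Vec d :=
  (N : ℝ)⁻¹ • ∑ j, diracVec (x j)

/-- The empirical measure of all players except the `i`-th (meaningful for `N ≥ 2`). -/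
def empiricalExcept {d N : ℕ} (i : Fin N) (x : Fin N → Fin d) : Vec d :=
  ((N : ℝ) - 1)⁻¹ • ∑ j ∈ Finset.univ.erase i, diracVec (x j)

/-- `D` is a derivative of `U` on the simplex: `[D m y]_z` is the one-sided derivative of `U` at
`m` along `δ_z - δ_y`, the limit being taken across admissible directions only (the filter is
trivial if the direction leaves the simplex). -/
def HasSimplexDeriv {d : ℕ} (U : Vec d → ℝ) (D : Vec d → Fin d → Vec d) : Prop :=
  ∀ m ∈ simplex d, ∀ y z : Fin d,
    Tendsto (fun s : ℝ => (U (m + s • (diracVec z - diracVec y)) - U m) / s)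
      (𝓝[{s : ℝ | 0 < s ∧ m + s • (diracVec z - diracVec y) ∈ simplex d}] 0)
      (𝓝 (D m y z))

/-- The data of the game: horizon, bounds on the rates, Lagrangian, running and terminal cost.
The Lagrangian is continuous in the control and, for all `x` and `p`, `a ↦ L x a + a · p` has a
unique minimizer over the control set. -/
structure Game (d : ℕ) where
  T : ℝ
  κ : ℝ
  M : ℝ
  L : Fin d → Vec d → ℝ
  F : Fin d → Vec d → ℝ
  G : Fin d → Vec d → ℝ
  T_pos : 0 < T
  κ_pos : 0 < κ
  κ_le_M : κ ≤ M
  L_continuousOn : ∀ x, ContinuousOn (L x) (controlSet d κ M)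
  existsUnique_minimizer : ∀ (x : Fin d) (p : Vec d), ∃! a : Vec d,
    a ∈ controlSet d κ M ∧ IsMinOn (fun b => L x b + inner ℝ b p) (controlSet d κ M) a

namespace Game

variable {d : ℕ} (𝒢 : Game d)

/-- The set of control values of the game. -/
def controls : Set (Vec d) := controlSet d 𝒢.κ 𝒢.M

/-- The Hamiltonian `H(x, p) = sup_{a} (- a · p - L(x, a))`. -/
def H (x : Fin d) (p : Vec d) : ℝ :=
  sSup ((fun a => - inner ℝ a p - 𝒢.L x a) '' 𝒢.controls)

/-- The optimal control `α*(x, p)`, the unique minimizer of `a ↦ L(x, a) + a · p`. -/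
def αstar (x : Fin d) (p : Vec d) : Vec d :=
  (𝒢.existsUnique_minimizer x p).choose

/-- `H` and `α*` are Lipschitz continuous in `p` for `|p| ≤ K`. -/
def H1 (K : ℝ) : Prop :=
  ∀ x, ∃ C : ℝ≥0, LipschitzOnWith C (𝒢.H x) (Metric.closedBall 0 K) ∧
    LipschitzOnWith C (𝒢.αstar x) (Metric.closedBall 0 K)

/-- `K` is large enough for the a priori bound on the finite differences of the value functions
read off the data, `K ≥ 2 √d (T (sup |H(·, 0)| + sup |F|) + sup |G|)`.  Here
`H(x, 0) = - min_a L(x, a)`. -/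
def IsAprioriRadius (K : ℝ) : Prop :=
  ∃ cH cF cG : ℝ, (∀ x, |𝒢.H x 0| ≤ cH) ∧
    (∀ x, ∀ m ∈ simplex d, |𝒢.F x m| ≤ cF) ∧
    (∀ x, ∀ m ∈ simplex d, |𝒢.G x m| ≤ cG) ∧
    2 * Real.sqrt d * (𝒢.T * (cH + cF) + cG) ≤ K

/-- `U` is a classical solution of the Master Equation, with derivative `D` in the measure. -/
structure IsClassicalSolution (U : ℝ → Fin d → Vec d → ℝ)
    (D : ℝ → Fin d → Vec d → Fin d → Vec d) : Prop where
  continuousOn : ∀ x, ContinuousOn (fun q : ℝ × Vec d => U q.1 x q.2)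
    (Icc 0 𝒢.T ×ˢ simplex d)
  contDiffOn_time : ∀ x, ∀ m ∈ simplex d, ContDiffOn ℝ 1 (fun t => U t x m) (Icc 0 𝒢.T)
  hasSimplexDeriv : ∀ t ∈ Icc 0 𝒢.T, ∀ x, HasSimplexDeriv (U t x) (D t x)
  continuousOn_deriv : ∀ t ∈ Icc 0 𝒢.T, ∀ x y, ContinuousOn (fun m => D t x m y) (simplex d)
  equation : ∀ t ∈ Icc 0 𝒢.T, ∀ x, ∀ m ∈ simplex d,
    - derivWithin (fun s => U s x m) (Icc 0 𝒢.T) t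
      + 𝒢.H x (stateDiff (fun y => U t y m) x)
      - ∑ y, m y * inner ℝ (D t x m y) (𝒢.αstar y (stateDiff (fun z => U t z m) y))
      = 𝒢.F x m
  terminal : ∀ x, ∀ m ∈ simplex d, U 𝒢.T x m = 𝒢.G x m

/-- `U` is a regular solution of the Master Equation: a classical solution whose derivative in
the measure is Lipschitz continuous in the measure, uniformly in time and state. -/
def IsRegularSolution (U : ℝ → Fin d → Vec d → ℝ) : Prop :=
  ∃ D : ℝ → Fin d → Vec d → Fin d → Vec d, 𝒢.IsClassicalSolution U D ∧
    ∃ C : ℝ, ∀ t ∈ Icc 0 𝒢.T, ∀ x y, ∀ m ∈ simplex d, ∀ m' ∈ simplex d,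
      ‖D t x m y - D t x m' y‖ ≤ C * ‖m - m'‖

/-- `v i t x`, `i : Fin N`, is a classical solution of the Hamilton-Jacobi-Bellman system of the
`N`-player game with the mean field costs `F(x_i, m^{N,i}_x)` and `G(x_i, m^{N,i}_x)`. -/
structure SolvesHJB {N : ℕ} (v : Fin N → ℝ → (Fin N → Fin d) → ℝ) : Prop where
  contDiffOn_time : ∀ i x, ContDiffOn ℝ 1 (fun t => v i t x) (Icc 0 𝒢.T)
  equation : ∀ i, ∀ t ∈ Icc 0 𝒢.T, ∀ x,
    - derivWithin (fun s => v i s x) (Icc 0 𝒢.T) t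
      - ∑ j ∈ Finset.univ.erase i,
          inner ℝ (𝒢.αstar (x j) (playerDiff j (v j t) x)) (playerDiff j (v i t) x)
      + 𝒢.H (x i) (playerDiff i (v i t) x)
      = 𝒢.F (x i) (empiricalExcept i x)
  terminal : ∀ i x, v i 𝒢.T x = 𝒢.G (x i) (empiricalExcept i x)

/-- The feedback strategies `α^i(t, x) = α*(x_i, Δ^i w^i(t, x))` induced by functions `w^i`. -/
def feedback {N : ℕ} (w : Fin N → ℝ → (Fin N → Fin d) → ℝ) :
    Fin N → ℝ → (Fin N → Fin d) → Vec d :=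
  fun i t x => 𝒢.αstar (x i) (playerDiff i (w i t) x)

end Game

/-- The projection `u^{N,i}(t, x) = U(t, x_i, m^{N,i}_x)` of a function on
`[0, T] × Σ × P(Σ)`. -/
def projection {d : ℕ} (N : ℕ) (U : ℝ → Fin d → Vec d → ℝ) :
    Fin N → ℝ → (Fin N → Fin d) → ℝ :=
  fun i t x => U t (x i) (empiricalExcept i x)

/-- The space of marks `Ξ = [0, M]^d`. -/
def markSet (d : ℕ) (M : ℝ) : Set (Vec d) := {ξ | ∀ y, ξ y ∈ Icc 0 M}

/-- The intensity `ν(E) = ∑_j ℓ(E ∩ Ξ_j)`, where `Ξ_j` is the part of the `j`-th coordinate axis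
in `Ξ` and `ℓ` is the Lebesgue measure on it. -/
def markIntensity (d : ℕ) (M : ℝ) : Measure (Vec d) :=
  ∑ j : Fin d, Measure.map (fun r : ℝ => (EuclideanSpace.single j r : Vec d))
    (volume.restrict (Icc 0 M))

/-- The intensity `dt ⊗ ν` on `[0, T] × Ξ` of the stationary Poisson random measures. -/
def noiseIntensity (d : ℕ) (T M : ℝ) : Measure (ℝ × Vec d) :=
  (volume.restrict (Icc 0 T)).prod (markIntensity d M)

/-- The jump function `f(x, ξ, a) = ∑_y (y - x) 1_{]0, a_y[}(ξ_y)`. -/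
def jump {d : ℕ} (x : Fin d) (ξ a : Vec d) : ℝ :=
  ∑ y, (label y - label x) * indicator (Ioo 0 (a y)) (fun _ => (1 : ℝ)) (ξ y)

/-- `𝒩` is a Poisson random measure with intensity `μ`: an integer-valued random measure with
independent values on disjoint sets, the value on a set of finite intensity `r` being Poisson
distributed with parameter `r`. -/
structure IsPoissonRandomMeasure {Ω S : Type*} [MeasurableSpace Ω] [MeasurableSpace S]
    (P : Measure Ω) (μ : Measure S) (𝒩 : Ω → Measure S) : Prop where
  measurable : Measurable 𝒩
  integerValued : ∀ ω, ∀ B, MeasurableSet B → ∃ n : ℕ∞, 𝒩 ω B = (n : ℝ≥0∞)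
  law : ∀ B, MeasurableSet B → μ B ≠ ∞ →
    P.map (fun ω => 𝒩 ω B)
      = (poissonMeasure (μ B).toNNReal).map (fun n : ℕ => (n : ℝ≥0∞))
  indep : ∀ (n : ℕ) (B : Fin n → Set S), (∀ k, MeasurableSet (B k)) →
    Pairwise (fun k l => Disjoint (B k) (B l)) → iIndepFun (fun k ω => 𝒩 ω (B k)) P

/-- The noise of the players: independent Poisson random measures with the same intensity
`dt ⊗ ν`, which are Poisson with respect to the filtration `𝓕` (the restriction to times up to
`s` is known at time `s`, the restriction to later times is independent of `𝓕 s`). -/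
structure IsPlayerNoise {d N : ℕ} (T M : ℝ) {Ω : Type*} {mΩ : MeasurableSpace Ω}
    (P : Measure Ω) (𝓕 : Filtration ℝ mΩ) (𝒩 : Fin N → Ω → Measure (ℝ × Vec d)) : Prop where
  poisson : ∀ i, IsPoissonRandomMeasure P (noiseIntensity d T M) (𝒩 i)
  indep : iIndepFun 𝒩 P
  adapted : ∀ s ∈ Icc 0 T, ∀ i,
    Measurable[𝓕 s] (fun ω => (𝒩 i ω).restrict (Iic s ×ˢ univ))
  indep_future : ∀ s ∈ Icc 0 T, Indep (𝓕 s)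
    (⨆ i, MeasurableSpace.comap (fun ω => (𝒩 i ω).restrict (Ioi s ×ˢ univ)) inferInstance) P

/-- Initial states: i.i.d. with distribution `m₀` and known at time `0` (hence independent of
the noise). -/
structure IsInitialDatum {d N : ℕ} {Ω : Type*} {mΩ : MeasurableSpace Ω}
    (P : Measure Ω) (𝓕 : Filtration ℝ mΩ) (m₀ : Vec d) (Z : Fin N → Ω → Fin d) : Prop where
  measurable : ∀ i, Measurable[𝓕 0] (Z i)
  law : ∀ i x, P {ω | Z i ω = x} = ENNReal.ofReal (m₀ x)
  indep : iIndepFun Z P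

/-- A path is càdlàg on `[0, T]`, with values in the discrete state space. -/
def IsCadlag {d : ℕ} (T : ℝ) (φ : ℝ → Fin d) : Prop :=
  (∀ t ∈ Ico 0 T, ContinuousWithinAt φ (Ici t) t) ∧
    ∀ t ∈ Ioc 0 T, ∃ l, Tendsto φ (𝓝[<] t) (𝓝 l)

/-- `X` is a solution on `[0, T]`, adapted and with càdlàg paths, of the system
`X_i(t) = Z_i + ∫_0^t ∫_Ξ f(X_i(s-), ξ, α^i(s, X(s-))) 𝒩_i(ds, dξ)`. -/
structure SolvesSDE {d N : ℕ} (T M : ℝ) {Ω : Type*} {mΩ : MeasurableSpace Ω}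
    (P : Measure Ω) (𝓕 : Filtration ℝ mΩ) (𝒩 : Fin N → Ω → Measure (ℝ × Vec d))
    (Z : Fin N → Ω → Fin d) (α : Fin N → ℝ → (Fin N → Fin d) → Vec d)
    (X : Fin N → ℝ → Ω → Fin d) : Prop where
  adapted : ∀ i, ∀ t ∈ Icc 0 T, Measurable[𝓕 t] (X i t)
  cadlag : ∀ i ω, IsCadlag T (fun t => X i t ω)
  equation : ∀ᵐ ω ∂P, ∀ i, ∀ t ∈ Icc 0 T,
    label (X i t ω) = label (Z i ω)
      + ∫ p in Ioc 0 t ×ˢ markSet d M,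
          jump (Function.leftLim (fun r => X i r ω) p.1) p.2
            (α i p.1 (fun j => Function.leftLim (fun r => X j r ω) p.1)) ∂(𝒩 i ω)

end FiniteMFG

end

noncomputable section

namespace FiniteMFG

/-! ### Vectors and the simplex -/

/-! The value functions are compared analytically, the processes by a coupling.

Moving one opponent shifts the measure seen by player i by 1/(N-1) along δ_z - δ_y. Since D^mU is
Lipschitz in m, U has a first order expansion along such a step with error O(1/N²). Summing over the
N-1 opponents, the projections u^{N,i} solve the HJB system up to a residual O(1/N)
(`abs_residual_le`).

A maximum principle for u - v then gives |u - v| ≤ c/N, uniformly in time, player and state. Let W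
be the largest signed error at a given time. Where it is attained, the transport of the error by the
opponents has a favourable sign because rates are nonnegative. What remains is the change of the
opponents' controls: N-1 products of a control error O(W) with a difference Δ^j u^{N,i} = O(1/N),
hence O(W) in total (`neg_le_deriv_error`). An exponential weight in time absorbs this term
(`abs_projection_sub_le`). The Lipschitz constants of H and α* apply because the same maximum
principle bounds U and v a priori. No probability enters, so the estimates of u - v along the paths
hold for every ω.

For the processes, Y and X share initial states and noise. The mean of |Y_i - X_i| is controlled by
the intensity of the noise (`exists_lintegral_leftLim_le`). While Y_i = X_i, the rates differ by
O(1/N) plus O(1/N) times the number of players whose states differ; while Y_i ≠ X_i, a crude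
constant suffices. Hence the mismatch probabilities satisfy a Gronwall inequality with error O(1/N)
(`exists_majorant_le_of_rates`). The supremum in time costs nothing, because the integral of the
absolute jump difference already dominates every earlier time. Averaging over players gives the
bound for the empirical measures. -/

theorem inner_eq_sum {d : ℕ} (a p : Vec d) : inner ℝ a p = ∑ z, a z * p z := by
  simp [PiLp.inner_apply, mul_comm]

theorem norm_le_sqrt_mul {d : ℕ} {p : Vec d} {c : ℝ} (hc : 0 ≤ c) (h : ∀ z, |p z| ≤ c) :
    ‖p‖ ≤ Real.sqrt d * c := by
  rw [EuclideanSpace.norm_eq]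
  have : ∑ z, ‖p z‖ ^ 2 ≤ d * c ^ 2 := by
    calc ∑ z, ‖p z‖ ^ 2 ≤ ∑ _z : Fin d, c ^ 2 :=
          Finset.sum_le_sum fun z _ => pow_le_pow_left₀ (norm_nonneg _) (h z) 2
      _ = d * c ^ 2 := by simp
  calc Real.sqrt (∑ z, ‖p z‖ ^ 2) ≤ Real.sqrt (d * c ^ 2) := Real.sqrt_le_sqrt this
    _ = Real.sqrt d * c := by rw [Real.sqrt_mul (by positivity), Real.sqrt_sq hc]

theorem abs_apply_le_norm {d : ℕ} (p : Vec d) (z : Fin d) : |p z| ≤ ‖p‖ :=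
  PiLp.norm_apply_le p z

theorem norm_diracVec {d : ℕ} (x : Fin d) : ‖diracVec x‖ = 1 := by
  simp [diracVec]

theorem norm_diracVec_sub_le {d : ℕ} (x y : Fin d) : ‖diracVec x - diracVec y‖ ≤ 2 := by
  calc _ ≤ ‖diracVec x‖ + ‖diracVec y‖ := norm_sub_le _ _
    _ = 2 := by rw [norm_diracVec, norm_diracVec]; norm_num

theorem diracVec_mem_simplex {d : ℕ} (x : Fin d) : diracVec x ∈ simplex d := by
  refine ⟨fun y => ?_, ?_⟩
  · simp only [diracVec, PiLp.single_apply]; split_ifs <;> norm_num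
  · simp [diracVec]

theorem convex_simplex (d : ℕ) : Convex ℝ (simplex d) := by
  intro m hm m' hm' a b ha hb hab
  refine ⟨fun x => ?_, ?_⟩
  · have := hm.1 x; have := hm'.1 x
    simp only [PiLp.add_apply, PiLp.smul_apply, smul_eq_mul]; positivity
  · simp only [PiLp.add_apply, PiLp.smul_apply, smul_eq_mul, Finset.sum_add_distrib,
      ← Finset.mul_sum, hm.2, hm'.2]
    linarith

theorem isCompact_simplex (d : ℕ) : IsCompact (simplex d) := by
  have h := (isCompact_stdSimplex ℝ (Fin d)).image
    (PiLp.continuous_toLp 2 (fun _ : Fin d => ℝ))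
  convert h using 1
  ext m
  constructor
  · intro hm
    exact ⟨m.ofLp, ⟨hm.1, hm.2⟩, rfl⟩
  · rintro ⟨f, hf, rfl⟩
    exact ⟨hf.1, hf.2⟩

theorem norm_sub_le_of_mem_simplex {d : ℕ} {m m' : Vec d} (hm : m ∈ simplex d)
    (hm' : m' ∈ simplex d) : ‖m - m'‖ ≤ 2 := by
  have key : ∀ m ∈ simplex d, ‖m‖ ≤ 1 := by
    intro m hm
    have : m = ∑ x, m x • diracVec x := by
      ext z
      simp [diracVec, Pi.single_apply]
    rw [this]
    calc _ ≤ ∑ x, ‖m x • diracVec x‖ := norm_sum_le _ _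
      _ = ∑ x, m x := Finset.sum_congr rfl fun x _ => by
          rw [norm_smul, norm_diracVec, mul_one, Real.norm_of_nonneg (hm.1 x)]
      _ = 1 := hm.2
  linarith [norm_sub_le m m', key m hm, key m' hm']

theorem add_smul_mem_simplex {d : ℕ} {m e : Vec d} {h s : ℝ} (hm : m ∈ simplex d)
    (hmh : m + h • e ∈ simplex d) (hs : s ∈ Icc 0 h) : m + s • e ∈ simplex d := by
  rcases eq_or_lt_of_le (hs.1.trans hs.2) with h0 | h0
  · have : s = 0 := le_antisymm (hs.2.trans h0.symm.le) hs.1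
    simpa [this] using hm
  · have := convex_simplex d hm hmh (a := 1 - s / h) (b := s / h)
      (by rw [sub_nonneg, div_le_one h0]; exact hs.2) (div_nonneg hs.1 h0.le) (by ring)
    convert this using 1
    rw [smul_add, smul_smul, div_mul_cancel₀ _ h0.ne', ← add_assoc, ← add_smul]
    simp

/-! ### A maximum principle -/

/-- If `t ↦ f t q` increases strictly at each maximum point `q` of `f t` at which `f t` exceeds
`g`, then a bound by `g` at the final time propagates to all earlier times. -/
theorem le_of_hasDerivWithinAt_pos_at_max {S : Type*} [TopologicalSpace S] {s : Set S}
    (hs : IsCompact s) {T g : ℝ} {f f' : ℝ → S → ℝ}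
    (hcont : ContinuousOn (fun q : ℝ × S => f q.1 q.2) (Icc 0 T ×ˢ s))
    (hderiv : ∀ t ∈ Icc 0 T, ∀ q ∈ s, HasDerivWithinAt (fun t => f t q) (f' t q) (Icc 0 T) t)
    (hT : ∀ q ∈ s, f T q ≤ g)
    (hpos : ∀ t ∈ Icc 0 T, ∀ q ∈ s, (∀ q' ∈ s, f t q' ≤ f t q) → g < f t q → 0 < f' t q) :
    ∀ t ∈ Icc 0 T, ∀ q ∈ s, f t q ≤ g := by
  intro t ht q hq
  obtain ⟨⟨t₀, q₀⟩, ⟨ht₀, hq₀⟩, hmax⟩ :=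
    (isCompact_Icc.prod hs).exists_isMaxOn ⟨(t, q), ht, hq⟩ hcont
  have hmax' : ∀ t ∈ Icc 0 T, ∀ q ∈ s, f t q ≤ f t₀ q₀ := fun t ht q hq =>
    hmax (show (t, q) ∈ Icc 0 T ×ˢ s from ⟨ht, hq⟩)
  refine (hmax' t ht q hq).trans ?_
  by_contra! hlt
  have hd := hderiv t₀ ht₀ q₀ hq₀
  have hp := hpos t₀ ht₀ q₀ hq₀ (fun q' hq' => hmax' t₀ ht₀ q' hq') hlt
  have htT : t₀ < T := lt_of_le_of_ne ht₀.2 fun h => by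
    subst h; exact absurd (hT q₀ hq₀) (not_le.2 hlt)
  -- Only the derivative to the right of `t₀` is used, so a maximum at time 0 is covered and only
  -- the final time has to be excluded.
  have hd' : HasDerivWithinAt (fun t => f t q₀) (f' t₀ q₀) (Ioi t₀) t₀ :=
    hd.mono_of_mem_nhdsWithin (mem_of_superset (Ioc_mem_nhdsGT htT)
      (Ioc_subset_Icc_self.trans (Icc_subset_Icc_left ht₀.1)))
  have hslope := (hasDerivWithinAt_iff_tendsto_slope' (by simp)).1 hd'
  have hev : ∀ᶠ r in 𝓝[>] t₀, 0 < slope (fun t => f t q₀) t₀ r := hslope.eventually_const_lt hp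
  obtain ⟨r, hr, hr'⟩ := (hev.and (Ioc_mem_nhdsGT htT)).exists
  rw [slope_def_field] at hr
  have := hmax' r ⟨ht₀.1.trans hr'.1.le, hr'.2⟩ q₀ hq₀
  have h2 : f r q₀ - f t₀ q₀ ≤ 0 := by linarith
  have h3 : 0 ≤ r - t₀ := by linarith [hr'.1]
  exact absurd hr (not_lt.2 (div_nonpos_of_nonpos_of_nonneg h2 h3))

/-- If `t ↦ f t q` decreases with rate at most `c` at each maximum point `q` of `f t`, then
`f` exceeds its final bound by at most `c` times the remaining time. -/
theorem le_add_of_neg_le_deriv_at_max {S : Type*} [TopologicalSpace S] {s : Set S}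
    (hs : IsCompact s) {T g c : ℝ} {f f' : ℝ → S → ℝ}
    (hcont : ContinuousOn (fun q : ℝ × S => f q.1 q.2) (Icc 0 T ×ˢ s))
    (hderiv : ∀ t ∈ Icc 0 T, ∀ q ∈ s, HasDerivWithinAt (fun t => f t q) (f' t q) (Icc 0 T) t)
    (hT : ∀ q ∈ s, f T q ≤ g)
    (hneg : ∀ t ∈ Icc 0 T, ∀ q ∈ s, (∀ q' ∈ s, f t q' ≤ f t q) → - c ≤ f' t q) :
    ∀ t ∈ Icc 0 T, ∀ q ∈ s, f t q ≤ g + c * (T - t) := by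
  intro t ht q hq
  -- The tilt (c + ε)(t - T) vanishes at T and makes the derivative at a maximum strictly positive;
  -- then ε tends to 0.
  have key : ∀ ε > 0, f t q ≤ g + (c + ε) * (T - t) := by
    intro ε hε
    have := le_of_hasDerivWithinAt_pos_at_max hs (T := T) (g := g)
      (f := fun t q => f t q + (c + ε) * (t - T)) (f' := fun t q => f' t q + (c + ε))
      (hcont.add (by fun_prop))
      (fun t ht q hq => (hderiv t ht q hq).add (by
        simpa using ((hasDerivWithinAt_id t (Icc 0 T)).sub_const T).const_mul (c + ε)))
      (fun q hq => by simpa using hT q hq)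
      (fun t ht q hq hmax _ => by
        have := hneg t ht q hq fun q' hq' => by simpa using hmax q' hq'
        linarith) t ht q hq
    linarith [this]
  have hlim : Tendsto (fun ε => g + (c + ε) * (T - t)) (𝓝[>] 0) (𝓝 (g + (c + 0) * (T - t))) :=
    (Continuous.tendsto (by fun_prop) 0).mono_left nhdsWithin_le_nhds
  simpa using ge_of_tendsto hlim (eventually_nhdsWithin_of_forall key)

/-! ### The Hamiltonian and the optimal control -/

namespace Game

variable {d : ℕ} (𝒢 : Game d)

theorem αstar_mem (x : Fin d) (p : Vec d) : 𝒢.αstar x p ∈ 𝒢.controls :=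
  (𝒢.existsUnique_minimizer x p).choose_spec.1.1

theorem αstar_isMinOn (x : Fin d) (p : Vec d) :
    IsMinOn (fun b => 𝒢.L x b + inner ℝ b p) 𝒢.controls (𝒢.αstar x p) :=
  (𝒢.existsUnique_minimizer x p).choose_spec.1.2

theorem αstar_nonneg (x : Fin d) (p : Vec d) (z : Fin d) : 0 ≤ 𝒢.αstar x p z :=
  𝒢.κ_pos.le.trans (𝒢.αstar_mem x p z).1

theorem αstar_le (x : Fin d) (p : Vec d) (z : Fin d) : 𝒢.αstar x p z ≤ 𝒢.M :=
  (𝒢.αstar_mem x p z).2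

theorem M_pos : 0 < 𝒢.M := 𝒢.κ_pos.trans_le 𝒢.κ_le_M

theorem norm_αstar_le (x : Fin d) (p : Vec d) : ‖𝒢.αstar x p‖ ≤ Real.sqrt d * 𝒢.M :=
  norm_le_sqrt_mul 𝒢.M_pos.le fun z => by
    rw [abs_of_nonneg (𝒢.αstar_nonneg x p z)]; exact 𝒢.αstar_le x p z

theorem isGreatest_H (x : Fin d) (p : Vec d) :
    IsGreatest ((fun a => - inner ℝ a p - 𝒢.L x a) '' 𝒢.controls)
      (- inner ℝ (𝒢.αstar x p) p - 𝒢.L x (𝒢.αstar x p)) := by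
  refine ⟨⟨_, 𝒢.αstar_mem x p, rfl⟩, ?_⟩
  rintro _ ⟨a, ha, rfl⟩
  have := 𝒢.αstar_isMinOn x p ha
  simp only [mem_ofPred_eq] at this
  linarith

theorem H_eq (x : Fin d) (p : Vec d) :
    𝒢.H x p = - inner ℝ (𝒢.αstar x p) p - 𝒢.L x (𝒢.αstar x p) :=
  (𝒢.isGreatest_H x p).csSup_eq

theorem le_H (x : Fin d) (p : Vec d) {a : Vec d} (ha : a ∈ 𝒢.controls) :
    - inner ℝ a p - 𝒢.L x a ≤ 𝒢.H x p := by
  rw [H_eq]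
  exact (𝒢.isGreatest_H x p).2 ⟨a, ha, rfl⟩

theorem inner_αstar_nonpos (x : Fin d) (q : Vec d) {p : Vec d} (hp : ∀ z, p z ≤ 0) :
    inner ℝ (𝒢.αstar x q) p ≤ 0 := by
  rw [inner_eq_sum]
  exact Finset.sum_nonpos fun z _ => mul_nonpos_of_nonneg_of_nonpos (𝒢.αstar_nonneg x q z) (hp z)

theorem inner_αstar_nonneg (x : Fin d) (q : Vec d) {p : Vec d} (hp : ∀ z, 0 ≤ p z) :
    0 ≤ inner ℝ (𝒢.αstar x q) p := by
  rw [inner_eq_sum]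
  exact Finset.sum_nonneg fun z _ => mul_nonneg (𝒢.αstar_nonneg x q z) (hp z)

/-- Controls have nonnegative entries, so -a · p - L increases as p decreases. This and `H_le_zero`
give the sign of the Hamiltonian term at a maximum or minimum of a value function, where the finite
differences have one sign. -/
theorem H_zero_le (x : Fin d) {p : Vec d} (hp : ∀ z, p z ≤ 0) : 𝒢.H x 0 ≤ 𝒢.H x p := by
  have h1 := 𝒢.le_H x p (𝒢.αstar_mem x 0)
  have h2 := 𝒢.inner_αstar_nonpos x 0 hp
  rw [𝒢.H_eq x 0, inner_zero_right]
  linarith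

theorem H_le_zero (x : Fin d) {p : Vec d} (hp : ∀ z, 0 ≤ p z) : 𝒢.H x p ≤ 𝒢.H x 0 := by
  have h1 := 𝒢.le_H x 0 (𝒢.αstar_mem x p)
  have h2 := 𝒢.inner_αstar_nonneg x p hp
  rw [inner_zero_right] at h1
  rw [𝒢.H_eq x p]
  linarith

end Game

/-! ### Derivatives on the simplex -/

theorem sum_diracVec {d : ℕ} (x : Fin d) : ∑ y, diracVec x y = 1 := (diracVec_mem_simplex x).2

theorem shift_mem_simplex {d : ℕ} {m : Vec d} (hm : m ∈ simplex d) {y : Fin d} (z : Fin d)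
    {s : ℝ} (hs : s ∈ Icc 0 (m y)) : m + s • (diracVec z - diracVec y) ∈ simplex d := by
  refine ⟨fun x => ?_, ?_⟩
  · have hx := hm.1 x
    have hs0 := hs.1
    have hs1 := hs.2
    simp only [diracVec, PiLp.add_apply, PiLp.smul_apply, PiLp.sub_apply, PiLp.single_apply,
      smul_eq_mul]
    by_cases hxy : x = y
    · subst hxy
      split_ifs <;> nlinarith
    · split_ifs <;> nlinarith
  · simp only [PiLp.add_apply, PiLp.smul_apply, PiLp.sub_apply, smul_eq_mul,
      Finset.sum_add_distrib, ← Finset.mul_sum, Finset.sum_sub_distrib, sum_diracVec, hm.2]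
    ring

theorem stateDiff_apply {d : ℕ} (g : Fin d → ℝ) (x y : Fin d) :
    stateDiff g x y = g y - g x := rfl

theorem playerDiff_apply {d N : ℕ} (j : Fin N) (g : (Fin N → Fin d) → ℝ) (x : Fin N → Fin d)
    (y : Fin d) : playerDiff j g x y = g (Function.update x j y) - g x := rfl

/-- Mass at y keeps the direction admissible for small s, so the filter of the limit is nontrivial
and the sign of the difference quotients passes to `D m y z`. If `m y = 0` nothing can be said, but
there the Master Equation carries the factor `m y`. -/
theorem HasSimplexDeriv.nonpos_of_max {d : ℕ} {V : Vec d → ℝ} {D : Vec d → Fin d → Vec d}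
    (h : HasSimplexDeriv V D) {m : Vec d} (hm : m ∈ simplex d)
    (hmax : ∀ m' ∈ simplex d, V m' ≤ V m) {y : Fin d} (hy : 0 < m y) (z : Fin d) :
    D m y z ≤ 0 := by
  have hlim := h m hm y z
  set A := {s : ℝ | 0 < s ∧ m + s • (diracVec z - diracVec y) ∈ simplex d} with hA
  have hsub : Ioc 0 (m y) ⊆ A := fun s hs => ⟨hs.1, shift_mem_simplex hm z ⟨hs.1.le, hs.2⟩⟩
  have hne : (𝓝[A] (0 : ℝ)).NeBot := by
    refine NeBot.mono (f := 𝓝[>] (0 : ℝ)) inferInstance ?_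
    exact nhdsWithin_le_iff.2 (mem_of_superset (Ioc_mem_nhdsGT hy) hsub)
  refine le_of_tendsto hlim (eventually_nhdsWithin_of_forall fun s hs => ?_)
  have := hmax _ hs.2
  exact div_nonpos_of_nonpos_of_nonneg (by linarith) hs.1.le

theorem HasSimplexDeriv.neg {d : ℕ} {V : Vec d → ℝ} {D : Vec d → Fin d → Vec d}
    (h : HasSimplexDeriv V D) : HasSimplexDeriv (fun m => - V m) (fun m y => - D m y) := by
  intro m hm y z
  refine (h m hm y z).neg.congr fun s => ?_
  ring

/-- At every point of the segment before its end the direction is still admissible, by convexity,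
and the defining limit at that point is the right derivative along the segment. -/
theorem HasSimplexDeriv.hasDerivWithinAt {d : ℕ} {V : Vec d → ℝ} {D : Vec d → Fin d → Vec d}
    (hD : HasSimplexDeriv V D) {m : Vec d} (hm : m ∈ simplex d) {y z : Fin d} {h s : ℝ}
    (hmh : m + h • (diracVec z - diracVec y) ∈ simplex d) (hs : s ∈ Ico 0 h) :
    HasDerivWithinAt (fun r => V (m + r • (diracVec z - diracVec y)))
      (D (m + s • (diracVec z - diracVec y)) y z) (Ici s) s := by
  set e := diracVec z - diracVec y with he
  have hmem : m + s • e ∈ simplex d := add_smul_mem_simplex hm hmh ⟨hs.1, hs.2.le⟩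
  have hlim := hD _ hmem y z
  rw [← he] at hlim
  have hlim' : Tendsto (fun r : ℝ => (V (m + s • e + r • e) - V (m + s • e)) / r) (𝓝[>] 0)
      (𝓝 (D (m + s • e) y z)) := by
    refine hlim.mono_left (nhdsWithin_le_iff.2 (mem_of_superset
      (Ioo_mem_nhdsGT (sub_pos.2 hs.2)) fun r hr => ⟨hr.1, ?_⟩))
    rw [add_assoc, ← add_smul]
    exact add_smul_mem_simplex hm hmh ⟨by linarith [hr.1, hs.1], by linarith [hr.2]⟩
  rw [← hasDerivWithinAt_Ioi_iff_Ici, hasDerivWithinAt_iff_tendsto_slope' (by simp)]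
  have hshift : Tendsto (fun r => r - s) (𝓝[>] s) (𝓝[>] 0) := by
    refine tendsto_nhdsWithin_iff.2 ⟨?_, eventually_nhdsWithin_of_forall fun r hr => ?_⟩
    · exact ((continuous_id.sub continuous_const).tendsto' s 0 (by simp)).mono_left
        nhdsWithin_le_nhds
    · exact sub_pos.2 (mem_Ioi.1 hr)
  refine (hlim'.comp hshift).congr fun r => ?_
  simp only [Function.comp, slope_def_field]
  rw [add_assoc, ← add_smul]
  congr 5
  ring

/-- First order expansion along an elementary direction. -/
theorem HasSimplexDeriv.abs_sub_le {d : ℕ} {V : Vec d → ℝ} {D : Vec d → Fin d → Vec d}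
    (hD : HasSimplexDeriv V D) (hV : ContinuousOn V (simplex d)) {C : ℝ} (hC : 0 ≤ C)
    {y : Fin d} (hLip : ∀ m ∈ simplex d, ∀ m' ∈ simplex d, ‖D m y - D m' y‖ ≤ C * ‖m - m'‖)
    {m : Vec d} (hm : m ∈ simplex d) {z : Fin d} {h : ℝ} (hh : 0 ≤ h)
    (hmh : m + h • (diracVec z - diracVec y) ∈ simplex d) :
    |V (m + h • (diracVec z - diracVec y)) - V m - h * D m y z| ≤ 2 * C * h ^ 2 := by
  set e := diracVec z - diracVec y with he
  have hmem : ∀ s ∈ Icc 0 h, m + s • e ∈ simplex d := fun s hs => add_smul_mem_simplex hm hmh hs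
  -- Subtracting the linear term leaves a function whose right derivative D(m + s e) - D(m) is at
  -- most C s ‖e‖ ≤ 2 C h, as ‖e‖ ≤ 2. Right derivatives suffice for the mean value inequality.
  have key := norm_image_sub_le_of_norm_deriv_right_le_segment
    (f := fun s => V (m + s • e) - s * D m y z)
    (f' := fun s => D (m + s • e) y z - D m y z) (C := 2 * C * h) (a := 0) (b := h)
    (by
      refine (hV.comp (by fun_prop) hmem).sub (by fun_prop))
    (fun s hs => (hD.hasDerivWithinAt hm hmh hs).sub (by
      simpa using (hasDerivWithinAt_id s (Ici s)).mul_const (D m y z)))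
    (fun s hs => by
      have h1 := hLip _ (hmem s ⟨hs.1, hs.2.le⟩) m hm
      have h2 := abs_apply_le_norm (D (m + s • e) y - D m y) z
      rw [PiLp.sub_apply] at h2
      rw [Real.norm_eq_abs]
      refine (h2.trans h1).trans ?_
      rw [add_sub_cancel_left, norm_smul, Real.norm_of_nonneg hs.1]
      have h3 := norm_diracVec_sub_le z y
      have : s * ‖e‖ ≤ h * 2 := mul_le_mul hs.2.le h3 (norm_nonneg _) hh
      nlinarith)
    h (right_mem_Icc.2 hh)
  simp only [Real.norm_eq_abs, zero_smul, add_zero, zero_mul, sub_zero] at key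
  rw [show V (m + h • e) - V m - h * D m y z = V (m + h • e) - h * D m y z - V m by ring]
  linarith [key]

/-- The full step from the vertex δ_y to δ_z bounds the derivative at δ_y by 2B + 2C, and the
Lipschitz condition carries this to any m at cost 2C. The bound depends on B and C only, hence will
be uniform in time. -/
theorem HasSimplexDeriv.abs_apply_le {d : ℕ} {V : Vec d → ℝ} {D : Vec d → Fin d → Vec d}
    (hD : HasSimplexDeriv V D) (hV : ContinuousOn V (simplex d)) {B C : ℝ} (hC : 0 ≤ C)
    (hB : ∀ m ∈ simplex d, |V m| ≤ B) {y : Fin d}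
    (hLip : ∀ m ∈ simplex d, ∀ m' ∈ simplex d, ‖D m y - D m' y‖ ≤ C * ‖m - m'‖)
    {m : Vec d} (hm : m ∈ simplex d) (z : Fin d) : |D m y z| ≤ 2 * B + 4 * C := by
  have hy := diracVec_mem_simplex y
  have hz := diracVec_mem_simplex z
  have h1 := hD.abs_sub_le hV hC hLip hy (z := z) (h := 1) zero_le_one (by simpa using hz)
  simp only [one_smul, add_sub_cancel, one_mul, one_pow, mul_one] at h1
  have h2 := hB _ hy
  have h3 := hB _ hz
  have h4 := (abs_apply_le_norm (D m y - D (diracVec y) y) z).trans (hLip m hm _ hy)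
  rw [PiLp.sub_apply] at h4
  have h5 : C * ‖m - diracVec y‖ ≤ C * 2 :=
    mul_le_mul_of_nonneg_left (norm_sub_le_of_mem_simplex hm hy) hC
  rw [abs_le] at *
  constructor <;> linarith [h4.1, h4.2, h1.1, h1.2, h2.1, h2.2, h3.1, h3.2]

theorem HasSimplexDeriv.abs_step_le {d : ℕ} {V : Vec d → ℝ} {D : Vec d → Fin d → Vec d}
    (hD : HasSimplexDeriv V D) (hV : ContinuousOn V (simplex d)) {B C : ℝ} (hC : 0 ≤ C)
    (hB : ∀ m ∈ simplex d, |V m| ≤ B) {y : Fin d}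
    (hLip : ∀ m ∈ simplex d, ∀ m' ∈ simplex d, ‖D m y - D m' y‖ ≤ C * ‖m - m'‖)
    {m : Vec d} (hm : m ∈ simplex d) {z : Fin d} {h : ℝ} (hh : 0 ≤ h) (hh1 : h ≤ 1)
    (hmh : m + h • (diracVec z - diracVec y) ∈ simplex d) :
    |V (m + h • (diracVec z - diracVec y)) - V m| ≤ (2 * B + 6 * C) * h := by
  have h1 := hD.abs_sub_le hV hC hLip hm hh hmh
  have h2 := hD.abs_apply_le hV hC hB hLip hm z
  have h3 : |h * D m y z| ≤ h * (2 * B + 4 * C) := by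
    rw [abs_mul, abs_of_nonneg hh]; exact mul_le_mul_of_nonneg_left h2 hh
  have h4 : 2 * C * h ^ 2 ≤ 2 * C * h := by nlinarith [mul_nonneg hC hh]
  have h5 := abs_add_le (V (m + h • (diracVec z - diracVec y)) - V m - h * D m y z) (h * D m y z)
  rw [sub_add_cancel] at h5
  linarith

/-! ### A priori bound for the solution of the Master Equation -/

namespace Game

variable {d : ℕ} {𝒢 : Game d}

theorem hasDerivWithinAt_of_contDiffOn {f : ℝ → ℝ} {T : ℝ} (hf : ContDiffOn ℝ 1 f (Icc 0 T))
    {t : ℝ} (ht : t ∈ Icc 0 T) :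
    HasDerivWithinAt f (derivWithin f (Icc 0 T) t) (Icc 0 T) t :=
  (hf.differentiableOn one_ne_zero t ht).hasDerivWithinAt

/-- Maximum principle on states times simplex. At a maximum of U(t, ·, ·) the differences in x and
the derivatives D^m in directions leaving charged states are nonpositive, so the equation bounds the
time derivative below by -(cH + cF); minima are symmetric. -/
theorem IsClassicalSolution.abs_value_le {U : ℝ → Fin d → Vec d → ℝ}
    {D : ℝ → Fin d → Vec d → Fin d → Vec d} (hU : 𝒢.IsClassicalSolution U D) {cH cF cG : ℝ}
    (hH : ∀ x, |𝒢.H x 0| ≤ cH) (hF : ∀ x, ∀ m ∈ simplex d, |𝒢.F x m| ≤ cF)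
    (hG : ∀ x, ∀ m ∈ simplex d, |𝒢.G x m| ≤ cG) {t : ℝ} (ht : t ∈ Icc 0 𝒢.T) (x : Fin d)
    {m : Vec d} (hm : m ∈ simplex d) : |U t x m| ≤ 𝒢.T * (cH + cF) + cG := by
  have hcomp : IsCompact ((univ : Set (Fin d)) ×ˢ simplex d) :=
    isCompact_univ.prod (isCompact_simplex d)
  have hcont : ContinuousOn (fun q : ℝ × (Fin d × Vec d) => U q.1 q.2.1 q.2.2)
      (Icc 0 𝒢.T ×ˢ ((univ : Set (Fin d)) ×ˢ simplex d)) := by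
    rintro ⟨t, x, m⟩ ⟨ht, -, hm⟩
    have h1 : ContinuousOn (fun q : ℝ × (Fin d × Vec d) => U q.1 x q.2.2)
        (Icc 0 𝒢.T ×ˢ ((univ : Set (Fin d)) ×ˢ simplex d)) :=
      (hU.continuousOn x).comp (f := fun q : ℝ × (Fin d × Vec d) => (q.1, q.2.2))
        (by fun_prop) (fun q hq => ⟨hq.1, hq.2.2⟩)
    -- The state is a discrete variable, so it may be frozen near each point.
    refine (h1 (t, x, m) ⟨ht, mem_univ _, hm⟩).congr_of_eventuallyEq ?_ rfl
    have h2 : ∀ᶠ q : ℝ × (Fin d × Vec d) in 𝓝 (t, x, m), q.2.1 = x :=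
      (continuous_snd.fst.tendsto (t, x, m)).eventually
        ((isOpen_discrete {x}).mem_nhds (mem_singleton x))
    filter_upwards [nhdsWithin_le_nhds h2] with q hq
    rw [hq]
  have hsum : 0 ≤ (cH + cF) := add_nonneg ((abs_nonneg _).trans (hH x))
    ((abs_nonneg _).trans (hF x m hm))
  have hle : cG + (cH + cF) * (𝒢.T - t) ≤ 𝒢.T * (cH + cF) + cG := by
    nlinarith [mul_nonneg hsum ht.1]
  rw [abs_le']
  constructor
  · refine le_trans ?_ hle
    refine le_add_of_neg_le_deriv_at_max hcomp (T := 𝒢.T) (f := fun t q => U t q.1 q.2)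
      (f' := fun t q => derivWithin (fun s => U s q.1 q.2) (Icc 0 𝒢.T) t) hcont
      (fun t ht q hq => hasDerivWithinAt_of_contDiffOn (hU.contDiffOn_time q.1 q.2 hq.2) ht)
      (fun q hq => ?_) (fun t ht q hq hmax => ?_) t ht (x, m) ⟨mem_univ _, hm⟩
    · rw [hU.terminal _ _ hq.2]
      exact (abs_le.1 (hG _ _ hq.2)).2
    · obtain ⟨x, m⟩ := q
      have hm : m ∈ simplex d := hq.2
      have heq := hU.equation t ht x m hm
      have h1 : 𝒢.H x 0 ≤ 𝒢.H x (stateDiff (fun y => U t y m) x) := 𝒢.H_zero_le x fun z => by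
        have := hmax (z, m) ⟨mem_univ _, hm⟩
        rw [stateDiff_apply]; linarith
      have h2 : ∑ y, m y * inner ℝ (D t x m y) (𝒢.αstar y (stateDiff (fun z => U t z m) y)) ≤ 0 := by
        refine Finset.sum_nonpos fun y _ => ?_
        rcases eq_or_lt_of_le (hm.1 y) with h0 | h0
        · rw [← h0, zero_mul]
        · refine mul_nonpos_of_nonneg_of_nonpos h0.le ?_
          rw [real_inner_comm]
          exact 𝒢.inner_αstar_nonpos _ _ fun z => (hU.hasSimplexDeriv t ht x).nonpos_of_max hm
            (fun m' hm' => hmax (x, m') ⟨mem_univ _, hm'⟩) h0 z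
      have h3 := (abs_le.1 (hF x m hm)).2
      have h4 := (abs_le.1 (hH x)).1
      simp only
      linarith
  · refine le_trans ?_ hle
    refine le_add_of_neg_le_deriv_at_max hcomp (T := 𝒢.T) (f := fun t q => - U t q.1 q.2)
      (f' := fun t q => - derivWithin (fun s => U s q.1 q.2) (Icc 0 𝒢.T) t) hcont.neg
      (fun t ht q hq => (hasDerivWithinAt_of_contDiffOn (hU.contDiffOn_time q.1 q.2 hq.2) ht).neg)
      (fun q hq => ?_) (fun t ht q hq hmax => ?_) t ht (x, m) ⟨mem_univ _, hm⟩
    · rw [hU.terminal _ _ hq.2]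
      exact neg_le.1 (abs_le.1 (hG _ _ hq.2)).1
    · obtain ⟨x, m⟩ := q
      have hm : m ∈ simplex d := hq.2
      have heq := hU.equation t ht x m hm
      have h1 : 𝒢.H x (stateDiff (fun y => U t y m) x) ≤ 𝒢.H x 0 := 𝒢.H_le_zero x fun z => by
        have := hmax (z, m) ⟨mem_univ _, hm⟩
        rw [stateDiff_apply]; linarith
      have h2 : 0 ≤ ∑ y, m y * inner ℝ (D t x m y) (𝒢.αstar y (stateDiff (fun z => U t z m) y)) := by
        refine Finset.sum_nonneg fun y _ => ?_
        rcases eq_or_lt_of_le (hm.1 y) with h0 | h0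
        · rw [← h0, zero_mul]
        · refine mul_nonneg h0.le ?_
          rw [real_inner_comm]
          refine 𝒢.inner_αstar_nonneg _ _ fun z => ?_
          have := (hU.hasSimplexDeriv t ht x).neg.nonpos_of_max hm
            (fun m' hm' => hmax (x, m') ⟨mem_univ _, hm'⟩) h0 z
          rw [PiLp.neg_apply] at this
          linarith
      have h3 := (abs_le.1 (hF x m hm)).1
      have h4 := (abs_le.1 (hH x)).2
      simp only
      linarith

/-- The same argument on the finite set of configurations: at a maximum of v^{N,i} every player's
difference of v^{N,i} is nonpositive, so the opponents' terms have a sign whatever their controls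
are. -/
theorem SolvesHJB.abs_value_le {N : ℕ} {v : Fin N → ℝ → (Fin N → Fin d) → ℝ} (hv : 𝒢.SolvesHJB v)
    {cH cF cG : ℝ} (hH : ∀ x, |𝒢.H x 0| ≤ cH)
    (hF : ∀ (i : Fin N) (x : Fin N → Fin d), |𝒢.F (x i) (empiricalExcept i x)| ≤ cF)
    (hG : ∀ (i : Fin N) (x : Fin N → Fin d), |𝒢.G (x i) (empiricalExcept i x)| ≤ cG) {t : ℝ} (ht : t ∈ Icc 0 𝒢.T)
    (i : Fin N) (x : Fin N → Fin d) : |v i t x| ≤ 𝒢.T * (cH + cF) + cG := by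
  have hcomp : IsCompact (univ : Set (Fin N → Fin d)) := isCompact_univ
  have hcont : ContinuousOn (fun q : ℝ × (Fin N → Fin d) => v i q.1 q.2)
      (Icc 0 𝒢.T ×ˢ univ) :=
    continuousOn_prod_of_discrete_right.2 fun x => by
      exact (hv.contDiffOn_time i x).continuousOn.mono fun t ht => ht.1
  have hsum : 0 ≤ (cH + cF) := add_nonneg ((abs_nonneg _).trans (hH (x i)))
    ((abs_nonneg _).trans (hF i x))
  have hle : cG + (cH + cF) * (𝒢.T - t) ≤ 𝒢.T * (cH + cF) + cG := by
    nlinarith [mul_nonneg hsum ht.1]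
  rw [abs_le']
  constructor
  · refine le_trans ?_ hle
    refine le_add_of_neg_le_deriv_at_max hcomp (T := 𝒢.T) (f := fun t q => v i t q)
      (f' := fun t q => derivWithin (fun s => v i s q) (Icc 0 𝒢.T) t) hcont
      (fun t ht q _ => hasDerivWithinAt_of_contDiffOn (hv.contDiffOn_time i q) ht)
      (fun q _ => ?_) (fun t ht x _ hmax => ?_) t ht x (mem_univ _)
    · rw [hv.terminal]
      exact (abs_le.1 (hG _ _)).2
    · have heq := hv.equation i t ht x
      have hd : ∀ j z, playerDiff j (v i t) x z ≤ 0 := fun j z => by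
        have := hmax (Function.update x j z) (mem_univ _)
        rw [playerDiff_apply]; linarith
      have h1 := 𝒢.H_zero_le (x i) (hd i)
      have h2 : ∑ j ∈ Finset.univ.erase i,
          inner ℝ (𝒢.αstar (x j) (playerDiff j (v j t) x)) (playerDiff j (v i t) x) ≤ 0 :=
        Finset.sum_nonpos fun j _ => 𝒢.inner_αstar_nonpos _ _ (hd j)
      have h3 := (abs_le.1 (hF i x)).2
      have h4 := (abs_le.1 (hH (x i))).1
      linarith
  · refine le_trans ?_ hle
    refine le_add_of_neg_le_deriv_at_max hcomp (T := 𝒢.T) (f := fun t q => - v i t q)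
      (f' := fun t q => - derivWithin (fun s => v i s q) (Icc 0 𝒢.T) t) hcont.neg
      (fun t ht q _ => (hasDerivWithinAt_of_contDiffOn (hv.contDiffOn_time i q) ht).neg)
      (fun q _ => ?_) (fun t ht x _ hmax => ?_) t ht x (mem_univ _)
    · rw [hv.terminal]
      exact neg_le.1 (abs_le.1 (hG _ _)).1
    · have heq := hv.equation i t ht x
      have hd : ∀ j z, 0 ≤ playerDiff j (v i t) x z := fun j z => by
        have := hmax (Function.update x j z) (mem_univ _)
        rw [playerDiff_apply]; linarith
      have h1 := 𝒢.H_le_zero (x i) (hd i)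
      have h2 : 0 ≤ ∑ j ∈ Finset.univ.erase i,
          inner ℝ (𝒢.αstar (x j) (playerDiff j (v j t) x)) (playerDiff j (v i t) x) :=
        Finset.sum_nonneg fun j _ => 𝒢.inner_αstar_nonneg _ _ (hd j)
      have h3 := (abs_le.1 (hF i x)).1
      have h4 := (abs_le.1 (hH (x i))).2
      linarith

end Game

/-! ### Empirical measures -/

section empirical

variable {d N : ℕ}

theorem inv_pred_pos (hN : 2 ≤ N) : 0 < ((N : ℝ) - 1)⁻¹ := by
  have : (2 : ℝ) ≤ N := by exact_mod_cast hN
  exact inv_pos.2 (by linarith)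

theorem inv_pred_le_one (hN : 2 ≤ N) : ((N : ℝ) - 1)⁻¹ ≤ 1 := by
  have : (2 : ℝ) ≤ N := by exact_mod_cast hN
  exact inv_le_one_of_one_le₀ (by linarith)

theorem card_erase_mul_inv (hN : 2 ≤ N) (i : Fin N) :
    ((Finset.univ.erase i).card : ℝ) * ((N : ℝ) - 1)⁻¹ = 1 := by
  have : (2 : ℝ) ≤ N := by exact_mod_cast hN
  rw [Finset.card_erase_of_mem (Finset.mem_univ i), Finset.card_univ, Fintype.card_fin,
    Nat.cast_sub (by omega), Nat.cast_one]
  exact mul_inv_cancel₀ (by linarith)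

/-- Turns the integral against m in the Master Equation into the average over opponents that appears
in the HJB system. -/
theorem sum_empiricalExcept_mul (i : Fin N) (x : Fin N → Fin d) (f : Fin d → ℝ) :
    ∑ y, empiricalExcept i x y * f y
      = ((N : ℝ) - 1)⁻¹ * ∑ j ∈ Finset.univ.erase i, f (x j) := by
  have : ∀ y, empiricalExcept i x y
      = ((N : ℝ) - 1)⁻¹ * ∑ j ∈ Finset.univ.erase i, diracVec (x j) y := by
    intro y
    simp [empiricalExcept]
  simp only [this, mul_assoc, ← Finset.mul_sum, Finset.sum_mul]
  rw [Finset.sum_comm]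
  congr 1
  refine Finset.sum_congr rfl fun j _ => ?_
  simp [diracVec]

theorem empiricalExcept_mem_simplex (hN : 2 ≤ N) (i : Fin N) (x : Fin N → Fin d) :
    empiricalExcept i x ∈ simplex d := by
  refine ⟨fun y => ?_, ?_⟩
  · have h0 := (inv_pred_pos hN).le
    simp only [empiricalExcept, PiLp.smul_apply, WithLp.ofLp_sum, Finset.sum_apply, smul_eq_mul]
    exact mul_nonneg h0 (Finset.sum_nonneg fun j _ => (diracVec_mem_simplex (x j)).1 y)
  · have := sum_empiricalExcept_mul i x fun _ => 1
    simp only [mul_one, Finset.sum_const, nsmul_eq_mul] at this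
    rw [this, mul_comm, card_erase_mul_inv hN]

theorem empiricalExcept_update_self (i : Fin N) (x : Fin N → Fin d) (z : Fin d) :
    empiricalExcept i (Function.update x i z) = empiricalExcept i x := by
  unfold empiricalExcept
  congr 1
  exact Finset.sum_congr rfl fun j hj => by
    rw [Function.update_of_ne (Finset.ne_of_mem_erase hj)]

theorem empiricalExcept_update_of_ne {i j : Fin N} (hij : j ≠ i) (x : Fin N → Fin d) (z : Fin d) :
    empiricalExcept i (Function.update x j z)
      = empiricalExcept i x + ((N : ℝ) - 1)⁻¹ • (diracVec z - diracVec (x j)) := by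
  unfold empiricalExcept
  rw [← smul_add]
  congr 1
  have hj : j ∈ Finset.univ.erase i := Finset.mem_erase.2 ⟨hij, Finset.mem_univ _⟩
  rw [← Finset.add_sum_erase _ _ hj, ← Finset.add_sum_erase _ (fun k => diracVec (x k)) hj,
    Function.update_self]
  have : ∑ k ∈ (Finset.univ.erase i).erase j, diracVec (Function.update x j z k)
      = ∑ k ∈ (Finset.univ.erase i).erase j, diracVec (x k) :=
    Finset.sum_congr rfl fun k hk => by
      rw [Function.update_of_ne (Finset.ne_of_mem_erase hk)]
  rw [this]
  abel

/-- Changing the excluded player is also one elementary step of size 1/(N-1), which allows opponent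
j's control, computed from his own empirical measure, to be compared with the one computed from
m^{N,i}. -/
theorem empiricalExcept_eq_add (i j : Fin N) (x : Fin N → Fin d) :
    empiricalExcept i x
      = empiricalExcept j x + ((N : ℝ) - 1)⁻¹ • (diracVec (x j) - diracVec (x i)) := by
  unfold empiricalExcept
  rw [← smul_add]
  congr 1
  have h1 := Finset.add_sum_erase Finset.univ (fun k => diracVec (x k)) (Finset.mem_univ i)
  have h2 := Finset.add_sum_erase Finset.univ (fun k => diracVec (x k)) (Finset.mem_univ j)
  rw [← h2] at h1
  rw [← sub_eq_zero] at h1 ⊢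
  rw [← h1]
  abel

end empirical

namespace Game

variable {d : ℕ} {𝒢 : Game d}

/-! ### Consistency of the projections of the Master Equation -/

/-- A classical solution of the Master Equation together with the constants that control it:
`B` bounds the solution, `C` is the Lipschitz constant of its derivative, and `LH`, `Lα` are
Lipschitz constants of the Hamiltonian and the optimal control on a ball that contains the
finite differences of all functions bounded by `B`. -/
structure ControlledSolution (𝒢 : Game d) (U : ℝ → Fin d → Vec d → ℝ)
    (D : ℝ → Fin d → Vec d → Fin d → Vec d) (K B C LH Lα : ℝ) : Prop where
  sol : 𝒢.IsClassicalSolution U D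
  C_nonneg : 0 ≤ C
  LH_nonneg : 0 ≤ LH
  Lα_nonneg : 0 ≤ Lα
  B_nonneg : 0 ≤ B
  lip : ∀ t ∈ Icc 0 𝒢.T, ∀ x y, ∀ m ∈ simplex d, ∀ m' ∈ simplex d,
      ‖D t x m y - D t x m' y‖ ≤ C * ‖m - m'‖
  abs_le : ∀ t ∈ Icc 0 𝒢.T, ∀ x, ∀ m ∈ simplex d, |U t x m| ≤ B
  le_radius : Real.sqrt d * (2 * B) ≤ K
  lip_H : ∀ x p q, ‖p‖ ≤ K → ‖q‖ ≤ K → |𝒢.H x p - 𝒢.H x q| ≤ LH * ‖p - q‖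
  lip_αstar : ∀ x p q, ‖p‖ ≤ K → ‖q‖ ≤ K → ‖𝒢.αstar x p - 𝒢.αstar x q‖ ≤ Lα * ‖p - q‖

theorem norm_playerDiff_le {N : ℕ} {g : (Fin N → Fin d) → ℝ} {B : ℝ} (hg : ∀ x, |g x| ≤ B)
    (j : Fin N) (x : Fin N → Fin d) : ‖playerDiff j g x‖ ≤ Real.sqrt d * (2 * B) := by
  have hB : 0 ≤ B := (abs_nonneg _).trans (hg x)
  refine norm_le_sqrt_mul (by linarith) fun z => ?_
  rw [playerDiff_apply]
  have := abs_sub (g (Function.update x j z)) (g x)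
  linarith [hg x, hg (Function.update x j z)]

theorem norm_stateDiff_le {g : Fin d → ℝ} {B : ℝ} (hg : ∀ x, |g x| ≤ B) (x : Fin d) :
    ‖stateDiff g x‖ ≤ Real.sqrt d * (2 * B) := by
  have hB : 0 ≤ B := (abs_nonneg _).trans (hg x)
  refine norm_le_sqrt_mul (by linarith) fun z => ?_
  rw [stateDiff_apply]
  have := abs_sub (g z) (g x)
  linarith [hg x, hg z]

/-- A player does not enter his own empirical measure, so the Hamiltonian term of the Master
Equation is reproduced without error. -/
theorem playerDiff_projection_self {N : ℕ} (U : ℝ → Fin d → Vec d → ℝ) (i : Fin N) (t : ℝ)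
    (x : Fin N → Fin d) :
    playerDiff i (projection N U i t) x
      = stateDiff (fun y => U t y (empiricalExcept i x)) (x i) := by
  ext z
  rw [playerDiff_apply, stateDiff_apply, projection, projection, empiricalExcept_update_self,
    Function.update_self]

namespace ControlledSolution

variable {U : ℝ → Fin d → Vec d → ℝ} {D : ℝ → Fin d → Vec d → Fin d → Vec d}
  {K B C LH Lα : ℝ} {N : ℕ}

theorem continuousOn_simplex (h : 𝒢.ControlledSolution U D K B C LH Lα) {t : ℝ}
    (ht : t ∈ Icc 0 𝒢.T) (x : Fin d) : ContinuousOn (U t x) (simplex d) :=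
  (h.sol.continuousOn x).comp (f := fun m => (t, m)) (by fun_prop) fun _ hm => ⟨ht, hm⟩

theorem abs_step_le (h : 𝒢.ControlledSolution U D K B C LH Lα) (hN : 2 ≤ N) {t : ℝ}
    (ht : t ∈ Icc 0 𝒢.T) (x : Fin d) {m : Vec d} (hm : m ∈ simplex d) {y z : Fin d}
    (hm' : m + ((N : ℝ) - 1)⁻¹ • (diracVec z - diracVec y) ∈ simplex d) :
    |U t x (m + ((N : ℝ) - 1)⁻¹ • (diracVec z - diracVec y)) - U t x m|
      ≤ (2 * B + 6 * C) * ((N : ℝ) - 1)⁻¹ :=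
  (h.sol.hasSimplexDeriv t ht x).abs_step_le (h.continuousOn_simplex ht x) h.C_nonneg
    (h.abs_le t ht x) (h.lip t ht x y) hm (inv_pred_pos hN).le (inv_pred_le_one hN) hm'

theorem abs_projection_update_sub_le (h : 𝒢.ControlledSolution U D K B C LH Lα) (hN : 2 ≤ N)
    {t : ℝ} (ht : t ∈ Icc 0 𝒢.T) {i j : Fin N} (hij : j ≠ i) (x : Fin N → Fin d) (z : Fin d) :
    |projection N U i t (Function.update x j z) - projection N U i t x|
      ≤ (2 * B + 6 * C) * ((N : ℝ) - 1)⁻¹ := by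
  have hm := empiricalExcept_mem_simplex hN i x
  have hm' := empiricalExcept_mem_simplex hN i (Function.update x j z)
  rw [empiricalExcept_update_of_ne hij] at hm'
  rw [projection, projection, empiricalExcept_update_of_ne hij, Function.update_of_ne hij.symm]
  exact h.abs_step_le hN ht (x i) hm hm'

theorem norm_playerDiff_projection_le (h : 𝒢.ControlledSolution U D K B C LH Lα) (hN : 2 ≤ N)
    {t : ℝ} (ht : t ∈ Icc 0 𝒢.T) {i j : Fin N} (hij : j ≠ i) (x : Fin N → Fin d) :
    ‖playerDiff j (projection N U i t) x‖
      ≤ Real.sqrt d * ((2 * B + 6 * C) * ((N : ℝ) - 1)⁻¹) :=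
  norm_le_sqrt_mul (mul_nonneg (by linarith [h.B_nonneg, h.C_nonneg]) (inv_pred_pos hN).le)
    fun z => h.abs_projection_update_sub_le hN ht hij x z

/-- An opponent's move is one elementary step, so the difference is 1/(N-1) times D^mU with an error
of second order, small enough to be summed over N-1 opponents. -/
theorem norm_playerDiff_projection_sub_le (h : 𝒢.ControlledSolution U D K B C LH Lα)
    (hN : 2 ≤ N) {t : ℝ} (ht : t ∈ Icc 0 𝒢.T) {i j : Fin N} (hij : j ≠ i)
    (x : Fin N → Fin d) :
    ‖playerDiff j (projection N U i t) x
        - ((N : ℝ) - 1)⁻¹ • D t (x i) (empiricalExcept i x) (x j)‖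
      ≤ Real.sqrt d * (2 * C * ((N : ℝ) - 1)⁻¹ ^ 2) := by
  refine norm_le_sqrt_mul (mul_nonneg (by linarith [h.C_nonneg]) (by positivity)) fun z => ?_
  have hm := empiricalExcept_mem_simplex hN i x
  have hm' := empiricalExcept_mem_simplex hN i (Function.update x j z)
  rw [empiricalExcept_update_of_ne hij] at hm'
  rw [PiLp.sub_apply, PiLp.smul_apply, playerDiff_apply, projection, projection,
    empiricalExcept_update_of_ne hij, Function.update_of_ne hij.symm, smul_eq_mul]
  exact (h.sol.hasSimplexDeriv t ht (x i)).abs_sub_le (h.continuousOn_simplex ht _) h.C_nonneg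
    (h.lip t ht _ _) hm (inv_pred_pos hN).le hm'

theorem norm_stateDiff_sub_le (h : 𝒢.ControlledSolution U D K B C LH Lα)
    (hN : 2 ≤ N) {t : ℝ} (ht : t ∈ Icc 0 𝒢.T) (i j : Fin N) (x : Fin N → Fin d) (y : Fin d) :
    ‖stateDiff (fun z => U t z (empiricalExcept i x)) y
        - stateDiff (fun z => U t z (empiricalExcept j x)) y‖
      ≤ Real.sqrt d * (2 * ((2 * B + 6 * C) * ((N : ℝ) - 1)⁻¹)) := by
  have h0 : 0 ≤ (2 * B + 6 * C) * ((N : ℝ) - 1)⁻¹ :=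
    mul_nonneg (by linarith [h.B_nonneg, h.C_nonneg]) (inv_pred_pos hN).le
  refine norm_le_sqrt_mul (by linarith) fun z => ?_
  have hm := empiricalExcept_mem_simplex hN j x
  have hm' := empiricalExcept_mem_simplex hN i x
  rw [empiricalExcept_eq_add i j] at hm'
  have h1 := h.abs_step_le hN ht z hm hm'
  have h2 := h.abs_step_le hN ht y hm hm'
  rw [← empiricalExcept_eq_add i j] at h1 h2
  rw [PiLp.sub_apply, stateDiff_apply, stateDiff_apply]
  have h3 := abs_sub (U t z (empiricalExcept i x) - U t z (empiricalExcept j x))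
    (U t y (empiricalExcept i x) - U t y (empiricalExcept j x))
  rw [show U t z (empiricalExcept i x) - U t y (empiricalExcept i x) -
    (U t z (empiricalExcept j x) - U t y (empiricalExcept j x)) =
    U t z (empiricalExcept i x) - U t z (empiricalExcept j x) -
    (U t y (empiricalExcept i x) - U t y (empiricalExcept j x)) by ring]
  linarith

theorem norm_stateDiff_le_radius (h : 𝒢.ControlledSolution U D K B C LH Lα) {t : ℝ}
    (ht : t ∈ Icc 0 𝒢.T) {m : Vec d} (hm : m ∈ simplex d) (y : Fin d) :
    ‖stateDiff (fun z => U t z m) y‖ ≤ K :=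
  (norm_stateDiff_le (fun z => h.abs_le t ht z m hm) y).trans h.le_radius

/-- The projections of the solution of the Master Equation solve the system of the `N`-player
game up to an error of order `1 / N`. -/
theorem abs_residual_le (h : 𝒢.ControlledSolution U D K B C LH Lα) (hN : 2 ≤ N)
    {t : ℝ} (ht : t ∈ Icc 0 𝒢.T) (i : Fin N) (x : Fin N → Fin d) :
    |- derivWithin (fun s => projection N U i s x) (Icc 0 𝒢.T) t
      - ∑ j ∈ Finset.univ.erase i,
          inner ℝ (𝒢.αstar (x j) (playerDiff j (projection N U j t) x))
            (playerDiff j (projection N U i t) x)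
      + 𝒢.H (x i) (playerDiff i (projection N U i t) x)
      - 𝒢.F (x i) (empiricalExcept i x)|
    ≤ (Real.sqrt d * 𝒢.M * (Real.sqrt d * (2 * C))
        + Lα * (Real.sqrt d * (2 * (2 * B + 6 * C))) * (Real.sqrt d * (2 * B + 4 * C)))
      * ((N : ℝ) - 1)⁻¹ := by
  set ε := ((N : ℝ) - 1)⁻¹ with hε
  have hε0 : 0 < ε := inv_pred_pos hN
  have hd0 : 0 ≤ Real.sqrt d := Real.sqrt_nonneg _
  have hm := empiricalExcept_mem_simplex hN i x
  have heq := h.sol.equation t ht (x i) _ hm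
  rw [sum_empiricalExcept_mul i x fun y => inner ℝ (D t (x i) (empiricalExcept i x) y)
    (𝒢.αstar y (stateDiff (fun z => U t z (empiricalExcept i x)) y)), ← hε,
    Finset.mul_sum] at heq
  -- Time derivative, Hamiltonian and cost cancel against the Master Equation at m^{N,i}, leaving
  -- one discrepancy per opponent.
  have hsplit : - derivWithin (fun s => projection N U i s x) (Icc 0 𝒢.T) t
      - ∑ j ∈ Finset.univ.erase i,
          inner ℝ (𝒢.αstar (x j) (playerDiff j (projection N U j t) x))
            (playerDiff j (projection N U i t) x)
      + 𝒢.H (x i) (playerDiff i (projection N U i t) x)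
      - 𝒢.F (x i) (empiricalExcept i x)
      = ∑ j ∈ Finset.univ.erase i,
        (ε * inner ℝ (D t (x i) (empiricalExcept i x) (x j))
          (𝒢.αstar (x j) (stateDiff (fun z => U t z (empiricalExcept i x)) (x j)))
        - inner ℝ (𝒢.αstar (x j) (playerDiff j (projection N U j t) x))
            (playerDiff j (projection N U i t) x)) := by
    rw [Finset.sum_sub_distrib, playerDiff_projection_self, ← heq]
    simp only [projection]
    ring
  rw [hsplit]
  refine (Finset.abs_sum_le_sum_abs _ _).trans ?_
  have hterm : ∀ j ∈ Finset.univ.erase i,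
      |ε * inner ℝ (D t (x i) (empiricalExcept i x) (x j))
          (𝒢.αstar (x j) (stateDiff (fun z => U t z (empiricalExcept i x)) (x j)))
        - inner ℝ (𝒢.αstar (x j) (playerDiff j (projection N U j t) x))
            (playerDiff j (projection N U i t) x)|
      ≤ (Real.sqrt d * 𝒢.M * (Real.sqrt d * (2 * C))
        + Lα * (Real.sqrt d * (2 * (2 * B + 6 * C))) * (Real.sqrt d * (2 * B + 4 * C)))
        * ε * ε := by
    intro j hj
    have hij : j ≠ i := Finset.ne_of_mem_erase hj
    set a := 𝒢.αstar (x j) (stateDiff (fun z => U t z (empiricalExcept i x)) (x j)) with ha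
    set a' := 𝒢.αstar (x j) (playerDiff j (projection N U j t) x) with ha'
    set δ := D t (x i) (empiricalExcept i x) (x j) with hδ
    set p := playerDiff j (projection N U i t) x with hp
    -- The first term is the error of the first order expansion. The second is the change of control
    -- from m^{N,i} to m^{N,j}, of order ε, paired with a derivative term of order ε.
    have e : ε * inner ℝ δ a - inner ℝ a' p
        = - inner ℝ a' (p - ε • δ) + inner ℝ (a - a') (ε • δ) := by
      rw [inner_sub_right, inner_sub_left, inner_smul_right, inner_smul_right,
        real_inner_comm a δ]
      ring
    have h1 : |inner ℝ a' (p - ε • δ)|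
        ≤ Real.sqrt d * 𝒢.M * (Real.sqrt d * (2 * C * ε ^ 2)) :=
      (abs_real_inner_le_norm _ _).trans (mul_le_mul (𝒢.norm_αstar_le _ _)
        (h.norm_playerDiff_projection_sub_le hN ht hij x) (norm_nonneg _)
        (mul_nonneg hd0 𝒢.M_pos.le))
    have h2 : ‖a - a'‖ ≤ Lα * (Real.sqrt d * (2 * ((2 * B + 6 * C) * ε))) := by
      rw [ha, ha', playerDiff_projection_self]
      refine (h.lip_αstar _ _ _ (h.norm_stateDiff_le_radius ht hm _)
        (h.norm_stateDiff_le_radius ht (empiricalExcept_mem_simplex hN j x) _)).trans ?_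
      exact mul_le_mul_of_nonneg_left (h.norm_stateDiff_sub_le hN ht i j x _) h.Lα_nonneg
    have h3 : ‖ε • δ‖ ≤ ε * (Real.sqrt d * (2 * B + 4 * C)) := by
      rw [norm_smul, Real.norm_of_nonneg hε0.le]
      refine mul_le_mul_of_nonneg_left (norm_le_sqrt_mul
        (by linarith [h.B_nonneg, h.C_nonneg]) fun z => ?_) hε0.le
      exact (h.sol.hasSimplexDeriv t ht (x i)).abs_apply_le (h.continuousOn_simplex ht _)
        h.C_nonneg (h.abs_le t ht _) (h.lip t ht _ _) hm z
    have h4 : |inner ℝ (a - a') (ε • δ)|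
        ≤ Lα * (Real.sqrt d * (2 * ((2 * B + 6 * C) * ε)))
          * (ε * (Real.sqrt d * (2 * B + 4 * C))) :=
      (abs_real_inner_le_norm _ _).trans (mul_le_mul h2 h3 (norm_nonneg _)
        ((norm_nonneg _).trans h2))
    rw [e]
    refine (abs_add_le _ _).trans ?_
    rw [abs_neg]
    refine (add_le_add h1 h4).trans (le_of_eq ?_)
    ring
  refine (Finset.sum_le_sum hterm).trans (le_of_eq ?_)
  rw [Finset.sum_const, nsmul_eq_mul]
  linear_combination (Real.sqrt d * 𝒢.M * (Real.sqrt d * (2 * C))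
        + Lα * (Real.sqrt d * (2 * (2 * B + 6 * C))) * (Real.sqrt d * (2 * B + 4 * C)))
      * ε * card_erase_mul_inv hN i

/-! ### Comparison with the solution of the `N`-player system -/

/-- At a point where the error of the `i`-th value function is extremal, its time derivative is
controlled by the supremum of the errors of all players. -/
theorem neg_le_deriv_error (h : 𝒢.ControlledSolution U D K B C LH Lα) (hN : 2 ≤ N)
    {v : Fin N → ℝ → (Fin N → Fin d) → ℝ} (hv : 𝒢.SolvesHJB v)
    (hvB : ∀ t ∈ Icc 0 𝒢.T, ∀ i x, |v i t x| ≤ B) {t : ℝ} (ht : t ∈ Icc 0 𝒢.T)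
    {W σ : ℝ} (hσ : σ = 1 ∨ σ = -1)
    (hW : ∀ i x, |projection N U i t x - v i t x| ≤ W) {i : Fin N} {x : Fin N → Fin d}
    (hmax : ∀ x', σ * (projection N U i t x' - v i t x')
      ≤ σ * (projection N U i t x - v i t x)) :
    - ((Lα * (Real.sqrt d * 2) * (Real.sqrt d * (2 * B + 6 * C)) + LH * (Real.sqrt d * 2)) * W
      + (Real.sqrt d * 𝒢.M * (Real.sqrt d * (2 * C))
        + Lα * (Real.sqrt d * (2 * (2 * B + 6 * C))) * (Real.sqrt d * (2 * B + 4 * C)))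
      * ((N : ℝ) - 1)⁻¹)
    ≤ σ * (derivWithin (fun s => projection N U i s x) (Icc 0 𝒢.T) t
      - derivWithin (fun s => v i s x) (Icc 0 𝒢.T) t) := by
  have hres := h.abs_residual_le hN ht i x
  have heq := hv.equation i t ht x
  set ε := ((N : ℝ) - 1)⁻¹ with hε
  have hε0 : 0 < ε := inv_pred_pos hN
  have hd0 : 0 ≤ Real.sqrt d := Real.sqrt_nonneg _
  have hσ1 : |σ| = 1 := by rcases hσ with rfl | rfl <;> simp
  set R := (Real.sqrt d * 𝒢.M * (Real.sqrt d * (2 * C))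
        + Lα * (Real.sqrt d * (2 * (2 * B + 6 * C))) * (Real.sqrt d * (2 * B + 4 * C))) * ε with hR
  have huB : ∀ i x, |projection N U i t x| ≤ B := fun i x =>
    h.abs_le t ht _ _ (empiricalExcept_mem_simplex hN i x)
  have hdiff : ∀ j k, playerDiff j (projection N U k t) x - playerDiff j (v k t) x
      = playerDiff j (fun x => projection N U k t x - v k t x) x := by
    intro j k
    ext z
    simp only [PiLp.sub_apply, playerDiff_apply]
    ring
  have hdW : ∀ j k, ‖playerDiff j (projection N U k t) x - playerDiff j (v k t) x‖
      ≤ Real.sqrt d * (2 * W) := by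
    intro j k
    rw [hdiff]
    exact norm_playerDiff_le (fun x => hW k x) j x
  have hru : ∀ j k, ‖playerDiff j (projection N U k t) x‖ ≤ K := fun j k =>
    (norm_playerDiff_le (huB k) j x).trans h.le_radius
  have hrv : ∀ j k, ‖playerDiff j (v k t) x‖ ≤ K := fun j k =>
    (norm_playerDiff_le (hvB t ht k) j x).trans h.le_radius
  -- the Hamiltonians
  have hH : σ * (𝒢.H (x i) (playerDiff i (projection N U i t) x)
      - 𝒢.H (x i) (playerDiff i (v i t) x)) ≥ - (LH * (Real.sqrt d * (2 * W))) := by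
    have h1 := (h.lip_H (x i) _ _ (hru i i) (hrv i i)).trans
      (mul_le_mul_of_nonneg_left (hdW i i) h.LH_nonneg)
    have h2 := neg_abs_le (σ * (𝒢.H (x i) (playerDiff i (projection N U i t) x)
      - 𝒢.H (x i) (playerDiff i (v i t) x)))
    rw [abs_mul, hσ1, one_mul] at h2
    linarith
  -- the other players
  have hterm : ∀ j ∈ Finset.univ.erase i,
      σ * (inner ℝ (𝒢.αstar (x j) (playerDiff j (projection N U j t) x))
            (playerDiff j (projection N U i t) x)
        - inner ℝ (𝒢.αstar (x j) (playerDiff j (v j t) x)) (playerDiff j (v i t) x))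
      ≤ Lα * (Real.sqrt d * (2 * W)) * (Real.sqrt d * ((2 * B + 6 * C) * ε)) := by
    intro j hj
    have hij : j ≠ i := Finset.ne_of_mem_erase hj
    set a := 𝒢.αstar (x j) (playerDiff j (v j t) x) with ha
    set a' := 𝒢.αstar (x j) (playerDiff j (projection N U j t) x) with ha'
    set p := playerDiff j (projection N U i t) x with hp
    set q := playerDiff j (v i t) x with hq
    -- The control difference is paired with the projection, whose differences are O(ε), and not
    -- with v, for which no such bound is known. The other term is transport of the error at
    -- nonnegative rates, nonpositive at an extremal point.
    have e : σ * (inner ℝ a' p - inner ℝ a q)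
        = σ * inner ℝ (a' - a) p + inner ℝ a (σ • (p - q)) := by
      rw [inner_smul_right, inner_sub_right, inner_sub_left]
      ring
    have h1 : inner ℝ a (σ • (p - q)) ≤ 0 := by
      refine 𝒢.inner_αstar_nonpos _ _ fun z => ?_
      rw [hp, hq, hdiff, PiLp.smul_apply, playerDiff_apply, smul_eq_mul]
      have := hmax (Function.update x j z)
      linarith
    have h2 : ‖a' - a‖ ≤ Lα * (Real.sqrt d * (2 * W)) :=
      (h.lip_αstar _ _ _ (hru j j) (hrv j j)).trans
        (mul_le_mul_of_nonneg_left (hdW j j) h.Lα_nonneg)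
    have h3 : |inner ℝ (a' - a) p|
        ≤ Lα * (Real.sqrt d * (2 * W)) * (Real.sqrt d * ((2 * B + 6 * C) * ε)) :=
      (abs_real_inner_le_norm _ _).trans (mul_le_mul h2
        (h.norm_playerDiff_projection_le hN ht hij x) (norm_nonneg _)
        ((norm_nonneg _).trans h2))
    have h4 := le_abs_self (σ * inner ℝ (a' - a) p)
    rw [abs_mul, hσ1, one_mul] at h4
    rw [e]
    linarith
  have hsum := Finset.sum_le_sum hterm
  rw [← Finset.mul_sum, Finset.sum_sub_distrib, Finset.sum_const, nsmul_eq_mul] at hsum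
  -- The N-1 opponents exactly offset the factor 1/(N-1), so the sum stays of order W uniformly in
  -- N.
  have hcard : ((Finset.univ.erase i).card : ℝ)
        * (Lα * (Real.sqrt d * (2 * W)) * (Real.sqrt d * ((2 * B + 6 * C) * ε)))
      = Lα * (Real.sqrt d * (2 * W)) * (Real.sqrt d * (2 * B + 6 * C)) := by
    linear_combination (Lα * (Real.sqrt d * (2 * W)) * (Real.sqrt d * (2 * B + 6 * C)))
      * card_erase_mul_inv hN i
  rw [hcard] at hsum
  set r := - derivWithin (fun s => projection N U i s x) (Icc 0 𝒢.T) t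
      - ∑ j ∈ Finset.univ.erase i,
          inner ℝ (𝒢.αstar (x j) (playerDiff j (projection N U j t) x))
            (playerDiff j (projection N U i t) x)
      + 𝒢.H (x i) (playerDiff i (projection N U i t) x)
      - 𝒢.F (x i) (empiricalExcept i x) with hr
  have hσr : σ * r ≤ R := by
    have h4 := le_abs_self (σ * r)
    rw [abs_mul, hσ1, one_mul] at h4
    linarith
  have hrw : σ * (derivWithin (fun s => projection N U i s x) (Icc 0 𝒢.T) t
      - derivWithin (fun s => v i s x) (Icc 0 𝒢.T) t)
      = σ * (𝒢.H (x i) (playerDiff i (projection N U i t) x)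
          - 𝒢.H (x i) (playerDiff i (v i t) x))
        - σ * (∑ j ∈ Finset.univ.erase i,
          inner ℝ (𝒢.αstar (x j) (playerDiff j (projection N U j t) x))
            (playerDiff j (projection N U i t) x)
          - ∑ j ∈ Finset.univ.erase i,
          inner ℝ (𝒢.αstar (x j) (playerDiff j (v j t) x)) (playerDiff j (v i t) x))
        - σ * r := by
    rw [hr, ← heq]
    ring
  rw [hrw]
  linarith

/-- The value functions of the `N`-player game are within `O(1 / N)` of the projections of the
solution of the Master Equation, uniformly in time and state. -/
theorem abs_projection_sub_le (h : 𝒢.ControlledSolution U D K B C LH Lα) :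
    ∃ c : ℝ, 0 ≤ c ∧ ∀ N : ℕ, 2 ≤ N → ∀ v : Fin N → ℝ → (Fin N → Fin d) → ℝ, 𝒢.SolvesHJB v →
      (∀ t ∈ Icc 0 𝒢.T, ∀ i x, |v i t x| ≤ B) →
      ∀ t ∈ Icc 0 𝒢.T, ∀ i x, |projection N U i t x - v i t x| ≤ c * ((N : ℝ) - 1)⁻¹ := by
  set R := Real.sqrt d * 𝒢.M * (Real.sqrt d * (2 * C))
        + Lα * (Real.sqrt d * (2 * (2 * B + 6 * C))) * (Real.sqrt d * (2 * B + 4 * C)) with hR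
  set b := Lα * (Real.sqrt d * 2) * (Real.sqrt d * (2 * B + 6 * C))
    + LH * (Real.sqrt d * 2) with hb
  have hM := 𝒢.M_pos
  have hT := 𝒢.T_pos
  obtain ⟨hC0, hLH0, hLα0, hB0⟩ := And.intro h.C_nonneg
    (And.intro h.LH_nonneg (And.intro h.Lα_nonneg h.B_nonneg))
  have hR0 : 0 ≤ R := by positivity
  have hb0 : 0 ≤ b := by positivity
  refine ⟨R * Real.exp ((b + 1) * 𝒢.T), by positivity, fun N hN v hv hvB => ?_⟩
  have hε0 : 0 < ((N : ℝ) - 1)⁻¹ := inv_pred_pos hN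
  set ε := ((N : ℝ) - 1)⁻¹ with hε
  set w : Fin N → ℝ → (Fin N → Fin d) → ℝ := fun i t x => projection N U i t x - v i t x with hw
  set w' : Fin N → ℝ → (Fin N → Fin d) → ℝ := fun i t x =>
    derivWithin (fun s => projection N U i s x) (Icc 0 𝒢.T) t
      - derivWithin (fun s => v i s x) (Icc 0 𝒢.T) t with hw'
  have hwd : ∀ i x, ∀ t ∈ Icc 0 𝒢.T,
      HasDerivWithinAt (fun t => w i t x) (w' i t x) (Icc 0 𝒢.T) t := fun i x t ht =>
    (hasDerivWithinAt_of_contDiffOn (h.sol.contDiffOn_time (x i) _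
      (empiricalExcept_mem_simplex hN i x)) ht).sub
      (hasDerivWithinAt_of_contDiffOn (hv.contDiffOn_time i x) ht)
  -- With the sign as an extra discrete variable, a maximum over all signs, players and
  -- configurations is the supremum norm of the error.
  let sg : Bool → ℝ := fun s => cond s 1 (-1)
  have hsg : ∀ s, sg s = 1 ∨ sg s = -1 := by intro s; cases s <;> simp [sg]
  have hfd : ∀ t ∈ Icc 0 𝒢.T, ∀ q ∈ (univ : Set (Bool × Fin N × (Fin N → Fin d))),
      HasDerivWithinAt (fun t => Real.exp ((b + 1) * t) * (sg q.1 * w q.2.1 t q.2.2))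
        (Real.exp ((b + 1) * t) * (b + 1) * (sg q.1 * w q.2.1 t q.2.2)
          + Real.exp ((b + 1) * t) * (sg q.1 * w' q.2.1 t q.2.2)) (Icc 0 𝒢.T) t := by
    intro t ht q _
    refine HasDerivWithinAt.mul ?_ ((hwd _ _ t ht).const_mul _)
    have := ((hasDerivWithinAt_id t (Icc 0 𝒢.T)).const_mul (b + 1)).exp
    simpa using this
  have key := le_of_hasDerivWithinAt_pos_at_max
    (isCompact_univ : IsCompact (univ : Set (Bool × Fin N × (Fin N → Fin d))))
    (T := 𝒢.T) (g := R * Real.exp ((b + 1) * 𝒢.T) * ε)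
    (f := fun t q => Real.exp ((b + 1) * t) * (sg q.1 * w q.2.1 t q.2.2)) (f' := _)
    (continuousOn_prod_of_discrete_right.2 fun q t ht =>
      ((hfd t ht.1 q (mem_univ _)).continuousWithinAt).mono fun t ht => ht.1)
    hfd
    (fun q _ => by
      have : w q.2.1 𝒢.T q.2.2 = 0 := by
        rw [hw]; simp only [projection]
        rw [h.sol.terminal _ _ (empiricalExcept_mem_simplex hN _ _), hv.terminal, sub_self]
      simp only [this, mul_zero]
      positivity)
    -- With W the maximal error, the derivative is at least e^{(b+1)t} ((b+1)W - bW - Rε) =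
    -- e^{(b+1)t} (W - Rε), positive once the weighted error exceeds Rε e^{(b+1)T}. This is why the
    -- exponent is b + 1.
    (fun t ht q _ hmax hlt => by
      obtain ⟨s, i, x⟩ := q
      simp only at hlt hmax ⊢
      have hexp : 0 < Real.exp ((b + 1) * t) := Real.exp_pos _
      have hmax' : ∀ s' i' x', sg s' * w i' t x' ≤ sg s * w i t x := fun s' i' x' =>
        le_of_mul_le_mul_left (hmax (s', i', x') (mem_univ _)) hexp
      have hW : ∀ i' x', |projection N U i' t x' - v i' t x'| ≤ sg s * w i t x := by
        intro i' x'
        have h1 := hmax' true i' x'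
        have h2 := hmax' false i' x'
        simp only [sg, cond_true, cond_false, one_mul, neg_mul] at h1 h2
        exact abs_le'.2 ⟨h1, h2⟩
      have hd := h.neg_le_deriv_error hN hv hvB ht (hsg s) hW (i := i) (x := x)
        (fun x' => hmax' s i x')
      have hle : Real.exp ((b + 1) * t) ≤ Real.exp ((b + 1) * 𝒢.T) :=
        Real.exp_le_exp.2 (mul_le_mul_of_nonneg_left ht.2 (by linarith))
      have h1 : R * ε * Real.exp ((b + 1) * t) ≤ R * ε * Real.exp ((b + 1) * 𝒢.T) :=
        mul_le_mul_of_nonneg_left hle (by positivity)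
      have h2 := mul_le_mul_of_nonneg_left hd hexp.le
      change _ ≤ Real.exp ((b + 1) * t) * (sg s * w' i t x) at h2
      linarith)
  intro t ht i x
  have h1 := key t ht (true, i, x) (mem_univ _)
  have h2 := key t ht (false, i, x) (mem_univ _)
  have hexp : 1 ≤ Real.exp ((b + 1) * t) :=
    Real.one_le_exp (mul_nonneg (by linarith) ht.1)
  have h3 : |Real.exp ((b + 1) * t) * w i t x| ≤ R * Real.exp ((b + 1) * 𝒢.T) * ε := by
    refine abs_le'.2 ⟨by simpa [sg] using h1, by simpa [sg] using h2⟩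
  rw [abs_mul, abs_of_pos (by positivity)] at h3
  exact (le_mul_of_one_le_left (abs_nonneg _) hexp).trans h3

end ControlledSolution

end Game

/-! ### Poisson random measures -/

theorem lintegral_natCast_poissonMeasure (r : ℝ≥0) :
    ∫⁻ n : ℕ, (n : ℝ≥0∞) ∂(poissonMeasure r) = r := by
  rw [poissonMeasure, lintegral_sum_measure]
  simp only [lintegral_smul_measure, lintegral_dirac, smul_eq_mul]
  rw [tsum_eq_zero_add' ENNReal.summable]
  simp only [Nat.cast_zero, mul_zero, zero_add]
  have hterm : ∀ n : ℕ, ENNReal.ofReal (Real.exp (-r) * r ^ (n + 1) / ((n + 1).factorial : ℝ))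
      * ((n + 1 : ℕ) : ℝ≥0∞)
      = r * ENNReal.ofReal (Real.exp (-r) * r ^ n / (n.factorial : ℝ)) := by
    intro n
    rw [← ENNReal.ofReal_natCast, ← ENNReal.ofReal_mul (by positivity),
      ← ENNReal.ofReal_coe_nnreal, ← ENNReal.ofReal_mul (by positivity), Nat.factorial_succ]
    congr 1
    have : (n.factorial : ℝ) ≠ 0 := by positivity
    have : ((n : ℝ) + 1) ≠ 0 := by positivity
    push_cast
    field_simp
    ring
  simp only [hterm]
  rw [ENNReal.tsum_mul_left, ← ENNReal.ofReal_tsum_of_nonneg (fun n => by positivity)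
    (hasSum_one_poissonMeasure r).summable, (hasSum_one_poissonMeasure r).tsum_eq]
  simp

namespace IsPoissonRandomMeasure

variable {Ω S : Type*} [MeasurableSpace Ω] [MeasurableSpace S] {P : Measure Ω} {μ : Measure S}
  {𝒩 : Ω → Measure S}

theorem lintegral_apply [IsFiniteMeasure μ] (h : IsPoissonRandomMeasure P μ 𝒩) {B : Set S}
    (hB : MeasurableSet B) : ∫⁻ ω, 𝒩 ω B ∂P = μ B := by
  have hm : Measurable fun ω => 𝒩 ω B := (Measure.measurable_coe hB).comp h.measurable
  have h1 : ∫⁻ r, r ∂(P.map fun ω => 𝒩 ω B) = ∫⁻ ω, 𝒩 ω B ∂P :=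
    lintegral_map measurable_id hm
  rw [← h1, h.law B hB (measure_ne_top μ B),
    lintegral_map (f := fun r : ℝ≥0∞ => r) measurable_id (by fun_prop),
    lintegral_natCast_poissonMeasure, ENNReal.coe_toNNReal (measure_ne_top μ B)]

/-- Campbell's formula: a Poisson variable has its parameter as mean, so the averaged random measure
`P.bind 𝒩` is the intensity. -/
theorem lintegral_lintegral [IsFiniteMeasure μ] (h : IsPoissonRandomMeasure P μ 𝒩)
    {f : S → ℝ≥0∞} (hf : Measurable f) : ∫⁻ ω, ∫⁻ p, f p ∂(𝒩 ω) ∂P = ∫⁻ p, f p ∂μ := by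
  have : P.bind 𝒩 = μ := by
    ext B hB
    rw [Measure.bind_apply hB h.measurable.aemeasurable, h.lintegral_apply hB]
  rw [← this, Measure.lintegral_bind h.measurable.aemeasurable hf.aemeasurable]

theorem ae_isFiniteMeasure [IsFiniteMeasure μ] (h : IsPoissonRandomMeasure P μ 𝒩) :
    ∀ᵐ ω ∂P, 𝒩 ω univ < ∞ := by
  refine ae_lt_top ((Measure.measurable_coe MeasurableSet.univ).comp h.measurable) ?_
  rw [h.lintegral_apply MeasurableSet.univ]
  exact measure_ne_top μ univ

end IsPoissonRandomMeasure

/-! ### Mean of integrals of adapted processes against the noise -/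

section compensation

variable {Ω E S : Type*} {mΩ : MeasurableSpace Ω} [MeasurableSpace E] {P : Measure Ω}
  {𝒩 : Ω → Measure (ℝ × E)}

/-- Mean of the integral of a deterministic function over later times, on an event known at
time `s`. -/
theorem lintegral_indicator_mul_lintegral_future {μ : Measure (ℝ × E)} [IsFiniteMeasure μ]
    (h𝒩 : IsPoissonRandomMeasure P μ 𝒩) {𝓕 : Filtration ℝ mΩ} {s : ℝ}
    (hind : Indep (𝓕 s)
      (MeasurableSpace.comap (fun ω => (𝒩 ω).restrict (Ioi s ×ˢ univ)) inferInstance) P)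
    {A : Set Ω} (hA : MeasurableSet[𝓕 s] A) {B : Set (ℝ × E)} (hB : MeasurableSet B)
    (hBs : B ⊆ Ioi s ×ˢ univ) {f : ℝ × E → ℝ≥0∞} (hf : Measurable f) :
    ∫⁻ ω, A.indicator 1 ω * ∫⁻ p in B, f p ∂(𝒩 ω) ∂P = P A * ∫⁻ p in B, f p ∂μ := by
  have hS : MeasurableSet (Ioi s ×ˢ (univ : Set E)) := measurableSet_Ioi.prod MeasurableSet.univ
  have hρ : Measurable fun ω => (𝒩 ω).restrict (Ioi s ×ˢ univ) :=
    Measure.measurable_of_measurable_coe _ fun B hB => by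
      simp only [Measure.restrict_apply hB]
      exact (Measure.measurable_coe (hB.inter hS)).comp h𝒩.measurable
  have heq : ∀ ω, ∫⁻ p in B, f p ∂(𝒩 ω)
      = ∫⁻ p, B.indicator f p ∂((𝒩 ω).restrict (Ioi s ×ˢ univ)) := by
    intro ω
    rw [lintegral_indicator hB, Measure.restrict_restrict hB, inter_eq_self_of_subset_left hBs]
  have hmeas : Measurable[MeasurableSpace.comap
      (fun ω => (𝒩 ω).restrict (Ioi s ×ˢ univ)) inferInstance]
      fun ω => ∫⁻ p in B, f p ∂(𝒩 ω) := by
    simp only [heq]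
    exact (Measure.measurable_lintegral (hf.indicator hB)).comp (comap_measurable _)
  have hone : Measurable[𝓕 s] (A.indicator (1 : Ω → ℝ≥0∞)) :=
    (@measurable_one ℝ≥0∞ Ω _ (𝓕 s) _).indicator hA
  rw [lintegral_mul_eq_lintegral_mul_lintegral_of_independent_measurableSpace (𝓕.le s)
    hρ.comap_le hind hone hmeas]
  congr 1
  · rw [lintegral_indicator_one (𝓕.le s A hA)]
  · simp only [← lintegral_indicator hB]
    exact h𝒩.lintegral_lintegral (hf.indicator hB)

theorem sum_setLIntegral_Ioc {a : ℕ → ℝ} (ha : Monotone a) (b : ℝ → ℝ≥0∞) (n : ℕ) :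
    ∑ k ∈ Finset.range n, ∫⁻ s in Ioc (a k) (a (k + 1)), b s = ∫⁻ s in Ioc (a 0) (a n), b s := by
  induction n with
  | zero => simp
  | succ n ih =>
    rw [Finset.sum_range_succ, ih, ← lintegral_union measurableSet_Ioc (Ioc_disjoint_Ioc_of_le le_rfl),
      Ioc_union_Ioc_eq_Ioc (ha (Nat.zero_le n)) (ha (Nat.le_succ n))]

/-- Half-open cells put the grid point strictly before s and within one mesh of it, so a process
frozen there approaches its left limit at s. -/
theorem exists_grid_index {t s : ℝ} (hs : s ∈ Ioc 0 t) (n : ℕ) :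
    ∃ k < n + 1, s ∈ Ioc (t * k / (n + 1)) (t * ((k + 1 : ℕ) : ℝ) / (n + 1))
      ∧ s - t / (n + 1) ≤ t * k / (n + 1) := by
  have ht : 0 < t := hs.1.trans_le hs.2
  have hn : (0 : ℝ) < n + 1 := by positivity
  have hq : 0 < s * (n + 1) / t := by have := hs.1; positivity
  have hk0 : 0 < ⌈s * (n + 1) / t⌉₊ := Nat.ceil_pos.2 hq
  obtain ⟨k, hk⟩ : ∃ k, ⌈s * (n + 1) / t⌉₊ = k + 1 := ⟨_, (Nat.succ_pred_eq_of_pos hk0).symm⟩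
  have h1 : s * (n + 1) / t ≤ ((k + 1 : ℕ) : ℝ) := hk ▸ Nat.le_ceil _
  have h2 : (k : ℝ) < s * (n + 1) / t := Nat.lt_ceil.1 (by omega)
  have h3 : k + 1 ≤ n + 1 := by
    rw [← hk]
    refine Nat.ceil_le.2 ?_
    rw [div_le_iff₀ ht]
    push_cast
    nlinarith [hs.2]
  rw [div_le_iff₀ ht] at h1
  rw [lt_div_iff₀ ht] at h2
  refine ⟨k, by omega, ⟨?_, ?_⟩, ?_⟩
  · rw [div_lt_iff₀ hn]; linarith
  · rw [le_div_iff₀ hn]; linarith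
  · rw [sub_le_iff_le_add, ← add_div, le_div_iff₀ hn]
    push_cast at h1
    linarith

/-- Compensation inequality: the mean of the integral of a function of the left limits of an
adapted process with finitely many states against a Poisson random measure is bounded by the
integral against the intensity. -/
theorem exists_lintegral_leftLim_le [IsProbabilityMeasure P] {T : ℝ} {ν : Measure E}
    [IsFiniteMeasure ν]
    (h𝒩 : IsPoissonRandomMeasure P ((volume.restrict (Icc 0 T)).prod ν) 𝒩)
    {𝓕 : Filtration ℝ mΩ}
    (hind : ∀ s ∈ Icc 0 T, Indep (𝓕 s)
      (MeasurableSpace.comap (fun ω => (𝒩 ω).restrict (Ioi s ×ˢ univ)) inferInstance) P)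
    [Fintype S] {Z Zl : ℝ → Ω → S}
    (hZ : ∀ t ∈ Icc 0 T, ∀ c, MeasurableSet[𝓕 t] {ω | Z t ω = c})
    (hZl : ∀ ω, ∀ s ∈ Ioc 0 T, ∀ᶠ r in 𝓝[<] s, Z r ω = Zl s ω)
    {f : S → ℝ × E → ℝ≥0∞} (hf : ∀ c, Measurable (f c)) {t : ℝ} (ht : t ∈ Icc 0 T)
    {b : ℝ → ℝ≥0∞}
    (hb : ∀ r s, 0 ≤ r → r < s → s ≤ t →
      ∑ c, P {ω | Z r ω = c} * ∫⁻ ξ, f c (s, ξ) ∂ν ≤ b s) :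
    ∃ R : Ω → ℝ≥0∞, Measurable R
      ∧ (∀ ω, ∫⁻ p in Ioc 0 t ×ˢ univ, f (Zl p.1 ω) p ∂(𝒩 ω) ≤ R ω)
      ∧ ∫⁻ ω, R ω ∂P ≤ ∫⁻ s in Ioc 0 t, b s := by
  classical
  let a : ℕ → ℕ → ℝ := fun n k => t * k / (n + 1)
  have ha0 : ∀ n k, 0 ≤ a n k := fun n k => by
    have := ht.1
    simp only [a]; positivity
  have hamono : ∀ n, Monotone (a n) := fun n k l hkl => by
    have h1 : (k : ℝ) ≤ l := by exact_mod_cast hkl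
    have h2 := mul_le_mul_of_nonneg_left h1 ht.1
    simp only [a]
    gcongr
  have han : ∀ n, a n (n + 1) = t := fun n => by
    simp only [a]; push_cast; field_simp
  have hale : ∀ n, ∀ k ≤ n + 1, a n k ≤ t := fun n k hk => (hamono n hk).trans_eq (han n)
  let I : ℕ → ℕ → Set (ℝ × E) := fun n k => Ioc (a n k) (a n (k + 1)) ×ˢ univ
  have hI : ∀ n k, MeasurableSet (I n k) := fun n k => measurableSet_Ioc.prod MeasurableSet.univ
  let A : ℕ → ℕ → S → Set Ω := fun n k c => {ω | Z (a n k) ω = c}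
  have hA : ∀ n, ∀ k ≤ n + 1, ∀ c, MeasurableSet[𝓕 (a n k)] (A n k c) := fun n k hk c =>
    hZ _ ⟨ha0 n k, (hale n k hk).trans ht.2⟩ c
  have hA' : ∀ n, ∀ k ≤ n + 1, ∀ c, MeasurableSet (A n k c) := fun n k hk c =>
    𝓕.le _ _ (hA n k hk c)
  -- On each cell the process is frozen at the left endpoint, which is known before the noise of the
  -- cell is revealed.
  let G : ℕ → Ω → ℝ≥0∞ := fun n ω => ∑ k ∈ Finset.range (n + 1), ∑ c,
    (A n k c).indicator 1 ω * ∫⁻ p in I n k, f c p ∂(𝒩 ω)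
  have hterm_meas : ∀ n, ∀ k ≤ n + 1, ∀ c, Measurable fun ω =>
      (A n k c).indicator (1 : Ω → ℝ≥0∞) ω * ∫⁻ p in I n k, f c p ∂(𝒩 ω) := by
    intro n k hk c
    refine (Measurable.indicator measurable_one (hA' n k hk c)).mul ?_
    simp only [← lintegral_indicator (hI n k)]
    exact (Measure.measurable_lintegral ((hf c).indicator (hI n k))).comp h𝒩.measurable
  have hG : ∀ n, Measurable (G n) := fun n =>
    Finset.measurable_sum _ fun k hk => Finset.measurable_sum _ fun c _ =>
      hterm_meas n k (Finset.mem_range.1 hk).le c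
  -- The lower limit of the discretised integrals is measurable; Fatou is used for `𝒩 ω` to dominate
  -- the integral, and again for `P` to bound the mean. Measurability of the integral itself in ω is
  -- never needed.
  refine ⟨fun ω => liminf (fun n => G n ω) atTop, Measurable.liminf hG, fun ω => ?_, ?_⟩
  · let g : ℕ → ℝ × E → ℝ≥0∞ := fun n p => ∑ k ∈ Finset.range (n + 1), ∑ c,
      (A n k c).indicator 1 ω * (I n k).indicator (f c) p
    have hgm : ∀ n, Measurable (g n) := fun n =>
      Finset.measurable_sum _ fun k _ => Finset.measurable_sum _ fun c _ =>
        ((hf c).indicator (hI n k)).const_mul _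
    have hgG : ∀ n, ∫⁻ p, g n p ∂(𝒩 ω) = G n ω := by
      intro n
      simp only [g, G]
      rw [lintegral_finsetSum _ fun k _ => Finset.measurable_sum _ fun c _ =>
        ((hf c).indicator (hI n k)).const_mul _]
      refine Finset.sum_congr rfl fun k _ => ?_
      rw [lintegral_finsetSum _ fun c _ => ((hf c).indicator (hI n k)).const_mul _]
      refine Finset.sum_congr rfl fun c _ => ?_
      rw [lintegral_const_mul _ ((hf c).indicator (hI n k)), lintegral_indicator (hI n k)]
    calc ∫⁻ p in Ioc 0 t ×ˢ univ, f (Zl p.1 ω) p ∂(𝒩 ω)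
        ≤ ∫⁻ p in Ioc 0 t ×ˢ univ, liminf (fun n => g n p) atTop ∂(𝒩 ω) := by
          refine setLIntegral_mono' (measurableSet_Ioc.prod MeasurableSet.univ) ?_
          rintro ⟨s, ξ⟩ ⟨hs, -⟩
          simp only at hs
          -- The path is constant just before s, so for fine grids the frozen state is the left
          -- limit.
          refine le_liminf_of_le (by isBoundedDefault) ?_
          obtain ⟨δ, hδ, hδZ⟩ := (mem_nhdsLT_iff_exists_Ioo_subset).1
            (hZl ω s ⟨hs.1, hs.2.trans ht.2⟩)
          have hlim : Tendsto (fun n : ℕ => t / ((n : ℝ) + 1)) atTop (𝓝 0) :=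
            mod_cast (tendsto_const_div_atTop_nhds_zero_nat t).comp (tendsto_add_atTop_nat 1)
          filter_upwards [hlim.eventually_lt_const (sub_pos.2 (mem_Iio.1 hδ))] with n hn
          obtain ⟨k, hk, hsk, hsk'⟩ := exists_grid_index hs n
          have hZk : Z (a n k) ω = Zl s ω := hδZ ⟨by simp only [a]; linarith, hsk.1⟩
          have hmem : (s, ξ) ∈ I n k := ⟨hsk, mem_univ _⟩
          have hmemA : ω ∈ A n k (Zl s ω) := hZk
          calc f (Zl s ω) (s, ξ)
              = (A n k (Zl s ω)).indicator 1 ω * (I n k).indicator (f (Zl s ω)) (s, ξ) := by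
                rw [indicator_of_mem hmem, indicator_of_mem hmemA, Pi.one_apply, one_mul]
            _ ≤ ∑ c, (A n k c).indicator 1 ω * (I n k).indicator (f c) (s, ξ) :=
                Finset.single_le_sum (f := fun c =>
                  (A n k c).indicator 1 ω * (I n k).indicator (f c) (s, ξ))
                  (fun c _ => zero_le) (Finset.mem_univ _)
            _ ≤ g n (s, ξ) :=
                Finset.single_le_sum (f := fun k => ∑ c,
                  (A n k c).indicator 1 ω * (I n k).indicator (f c) (s, ξ))
                  (fun k _ => zero_le) (Finset.mem_range.2 hk)
      _ ≤ ∫⁻ p, liminf (fun n => g n p) atTop ∂(𝒩 ω) := setLIntegral_le_lintegral _ _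
      _ ≤ liminf (fun n => ∫⁻ p, g n p ∂(𝒩 ω)) atTop := lintegral_liminf_le hgm
      _ = liminf (fun n => G n ω) atTop := by simp only [hgG]
  · refine (lintegral_liminf_le hG).trans ?_
    have hbound : ∀ n, ∫⁻ ω, G n ω ∂P ≤ ∫⁻ s in Ioc 0 t, b s := by
      intro n
      simp only [G]
      rw [lintegral_finsetSum _ fun k hk => Finset.measurable_sum _ fun c _ =>
        hterm_meas n k (Finset.mem_range.1 hk).le c]
      have hsum := sum_setLIntegral_Ioc (hamono n) b (n + 1)
      rw [han, show a n 0 = 0 by simp [a]] at hsum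
      rw [← hsum]
      refine Finset.sum_le_sum fun k hk => ?_
      have hk' : k < n + 1 := Finset.mem_range.1 hk
      have hsub : Ioc (a n k) (a n (k + 1)) ⊆ Icc 0 T := fun s hs =>
        ⟨(ha0 n k).trans hs.1.le, hs.2.trans ((hale n (k + 1) (by omega)).trans ht.2)⟩
      rw [lintegral_finsetSum _ fun c _ => hterm_meas n k hk'.le c]
      -- Independence of past and future noise factorises each cell. The state is taken at the left
      -- endpoint and f at a later s, hence the two times r < s in the hypothesis on b.
      have hc : ∀ c, ∫⁻ ω, (A n k c).indicator 1 ω * ∫⁻ p in I n k, f c p ∂(𝒩 ω) ∂P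
          = ∫⁻ s in Ioc (a n k) (a n (k + 1)), P (A n k c) * ∫⁻ ξ, f c (s, ξ) ∂ν := by
        intro c
        rw [lintegral_indicator_mul_lintegral_future h𝒩
          (hind _ ⟨ha0 n k, (hale n k hk'.le).trans ht.2⟩) (hA n k hk'.le c) (hI n k)
          (prod_mono Ioc_subset_Ioi_self subset_rfl) (hf c), ← Measure.prod_restrict,
          Measure.restrict_univ, Measure.restrict_restrict measurableSet_Ioc,
          inter_eq_self_of_subset_left hsub, lintegral_prod _ (hf c).aemeasurable,
          lintegral_const_mul _ (hf c).lintegral_prod_right']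
      simp only [hc]
      rw [← lintegral_finsetSum _ fun c _ => ((hf c).lintegral_prod_right').const_mul _]
      exact setLIntegral_mono' measurableSet_Ioc fun s hs =>
        hb _ s (ha0 n k) hs.1 (hs.2.trans (hale n (k + 1) (by omega)))
    exact liminf_le_of_le (by isBoundedDefault) fun c hc => by
      obtain ⟨n, hn⟩ := hc.exists
      exact hn.trans (hbound n)

end compensation

/-! ### Jumps -/

theorem abs_label_sub_le {d : ℕ} (x y : Fin d) : |label x - label y| ≤ d := by
  have hx : ((x : ℕ) : ℝ) ≤ d := by exact_mod_cast x.2.le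
  have hy : ((y : ℕ) : ℝ) ≤ d := by exact_mod_cast y.2.le
  have hx0 : (0 : ℝ) ≤ ((x : ℕ) : ℝ) := Nat.cast_nonneg _
  have hy0 : (0 : ℝ) ≤ ((y : ℕ) : ℝ) := Nat.cast_nonneg _
  rw [label, label, abs_le]
  constructor <;> linarith

theorem one_le_abs_label_sub {d : ℕ} {x y : Fin d} (h : x ≠ y) : 1 ≤ |label x - label y| := by
  have h1 : ((x : ℕ) : ℤ) - ((y : ℕ) : ℤ) ≠ 0 := by
    intro h0
    exact h (Fin.ext (by omega))
  have h2 : (1 : ℤ) ≤ |((x : ℕ) : ℤ) - ((y : ℕ) : ℤ)| := Int.one_le_abs h1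
  have h3 : (1 : ℝ) ≤ |((x : ℕ) : ℝ) - ((y : ℕ) : ℝ)| := by exact_mod_cast h2
  rw [label, label]
  simpa using h3

theorem abs_jump_le {d : ℕ} (x : Fin d) (ξ a : Vec d) : |jump x ξ a| ≤ (d : ℝ) * d := by
  refine (Finset.abs_sum_le_sum_abs _ _).trans ?_
  calc ∑ y, |(label y - label x) * indicator (Ioo 0 (a y)) (fun _ => (1 : ℝ)) (ξ y)|
      ≤ ∑ _y : Fin d, (d : ℝ) := Finset.sum_le_sum fun y _ => by
        rw [abs_mul]
        have h1 := abs_label_sub_le y x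
        have h2 : |indicator (Ioo 0 (a y)) (fun _ => (1 : ℝ)) (ξ y)| ≤ 1 := by
          by_cases h : ξ y ∈ Ioo 0 (a y) <;> simp [h]
        nlinarith [abs_nonneg (label y - label x)]
    _ = (d : ℝ) * d := by simp

theorem measurable_jump {d : ℕ} {α : Type*} [MeasurableSpace α] (x : Fin d) {ξ a : α → Vec d}
    (hξ : Measurable ξ) (ha : Measurable a) : Measurable fun p => jump x (ξ p) (a p) := by
  have hc : ∀ {g : α → Vec d}, Measurable g → ∀ y, Measurable fun p => g p y := fun hg y =>
    ((PiLp.continuous_apply 2 (fun _ : Fin d => ℝ) y).measurable).comp hg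
  refine Finset.measurable_sum _ fun y _ => Measurable.const_mul ?_ _
  have : (fun p => indicator (Ioo 0 (a p y)) (fun _ => (1 : ℝ)) (ξ p y))
      = indicator {p | 0 < ξ p y ∧ ξ p y < a p y} fun _ => (1 : ℝ) := by
    ext p
    simp only [indicator, mem_Ioo, mem_ofPred_eq]
  rw [this]
  exact measurable_const.indicator ((measurableSet_lt measurable_const (hc hξ y)).inter
    (measurableSet_lt (hc hξ y) (hc ha y)))

/-- A mark on the j-th axis has all other coordinates 0, which the open interval excludes; it can
only cause a jump to j. -/
theorem jump_single {d : ℕ} (x j : Fin d) (r : ℝ) (a : Vec d) :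
    jump x (EuclideanSpace.single j r) a
      = (label j - label x) * indicator (Ioo 0 (a j)) (fun _ => (1 : ℝ)) r := by
  rw [jump, Finset.sum_eq_single j]
  · simp
  · intro y _ hy
    simp [hy]
  · simp

theorem measurable_single {d : ℕ} (j : Fin d) :
    Measurable fun r : ℝ => (EuclideanSpace.single j r : Vec d) :=
  ((PiLp.continuous_toLp 2 (fun _ : Fin d => ℝ)).comp
    (continuous_single (A := fun _ : Fin d => ℝ) j)).measurable

theorem lintegral_markIntensity {d : ℕ} {M : ℝ} {f : Vec d → ℝ≥0∞} (hf : Measurable f) :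
    ∫⁻ ξ, f ξ ∂(markIntensity d M)
      = ∑ j : Fin d, ∫⁻ r in Icc 0 M, f (EuclideanSpace.single j r) := by
  rw [markIntensity, lintegral_finsetSum_measure]
  exact Finset.sum_congr rfl fun j _ => lintegral_map hf (measurable_single j)

theorem markIntensity_univ (d : ℕ) (M : ℝ) :
    markIntensity d M univ = d * ENNReal.ofReal M := by
  have := lintegral_markIntensity (d := d) (M := M) (f := fun _ => 1) measurable_const
  simpa using this

instance isFiniteMeasure_markIntensity (d : ℕ) (M : ℝ) : IsFiniteMeasure (markIntensity d M) :=
  ⟨by rw [markIntensity_univ]; exact ENNReal.mul_lt_top (by simp) (by simp)⟩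

instance isFiniteMeasure_noiseIntensity (d : ℕ) (T M : ℝ) :
    IsFiniteMeasure (noiseIntensity d T M) := by
  unfold noiseIntensity; infer_instance

theorem lintegral_abs_indicator_sub_le {c D a b M : ℝ} (hc : |c| ≤ D) :
    ∫⁻ r in Icc 0 M, ENNReal.ofReal |c * indicator (Ioo 0 a) (fun _ => (1 : ℝ)) r
      - c * indicator (Ioo 0 b) (fun _ => (1 : ℝ)) r| ≤ ENNReal.ofReal (D * |a - b|) := by
  have hD : 0 ≤ D := (abs_nonneg _).trans hc
  -- The two indicators can differ only between the rates; the smaller rate is included since the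
  -- open interval omits its right end.
  calc _ ≤ ∫⁻ r in Icc 0 M, (Ico (min a b) (max a b)).indicator (fun _ => ENNReal.ofReal D) r := by
        refine lintegral_mono fun r => ?_
        by_cases hr : r ∈ Ico (min a b) (max a b)
        · rw [indicator_of_mem hr]
          refine ENNReal.ofReal_le_ofReal (le_trans ?_ hc)
          rw [← mul_sub, abs_mul]
          refine mul_le_of_le_one_right (abs_nonneg _) ?_
          simp only [indicator]
          split_ifs <;> simp
        · have : (r ∈ Ioo 0 a ↔ r ∈ Ioo 0 b) := by
            simp only [mem_Ico, mem_Ioo, min_le_iff, lt_max_iff, not_and, not_or, not_lt] at hr ⊢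
            constructor
            · rintro ⟨h1, h2⟩
              refine ⟨h1, ?_⟩
              by_contra! h3
              linarith [(hr (Or.inr h3)).1]
            · rintro ⟨h1, h2⟩
              refine ⟨h1, ?_⟩
              by_contra! h3
              linarith [(hr (Or.inl h3)).2]
          simp only [indicator, this, sub_self, abs_zero, ENNReal.ofReal_zero]
          exact zero_le
    _ ≤ ∫⁻ r, (Ico (min a b) (max a b)).indicator (fun _ => ENNReal.ofReal D) r :=
        setLIntegral_le_lintegral _ _
    _ = ENNReal.ofReal (D * |a - b|) := by
        rw [lintegral_indicator_const measurableSet_Ico, Real.volume_Ico, max_sub_min_eq_abs,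
          abs_sub_comm, ← ENNReal.ofReal_mul hD]

theorem lintegral_abs_jump_sub_le {d : ℕ} {M : ℝ} (x : Fin d) (a b : Vec d) :
    ∫⁻ ξ, ENNReal.ofReal |jump x ξ a - jump x ξ b| ∂(markIntensity d M)
      ≤ ENNReal.ofReal (d * ∑ z, |a z - b z|) := by
  have hm : Measurable fun ξ : Vec d => ENNReal.ofReal |jump x ξ a - jump x ξ b| :=
    ((measurable_jump x measurable_id measurable_const).sub
      (measurable_jump x measurable_id measurable_const)).abs.ennreal_ofReal
  rw [lintegral_markIntensity hm, Finset.mul_sum,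
    ENNReal.ofReal_sum_of_nonneg fun z _ => by positivity]
  refine Finset.sum_le_sum fun j _ => ?_
  simp only [jump_single]
  exact lintegral_abs_indicator_sub_le (abs_label_sub_le j x)

theorem lintegral_abs_jump_sub_le_const {d : ℕ} {M : ℝ} (x y : Fin d) (a b : Vec d) :
    ∫⁻ ξ, ENNReal.ofReal |jump x ξ a - jump y ξ b| ∂(markIntensity d M)
      ≤ ENNReal.ofReal (2 * (d * d) * (d * M)) := by
  calc _ ≤ ∫⁻ _ξ, ENNReal.ofReal (2 * ((d : ℝ) * d)) ∂(markIntensity d M) := by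
        refine lintegral_mono fun ξ => ENNReal.ofReal_le_ofReal ?_
        have := abs_sub (jump x ξ a) (jump y ξ b)
        linarith [abs_jump_le x ξ a, abs_jump_le y ξ b]
    _ = ENNReal.ofReal (2 * (d * d) * (d * M)) := by
        have h : (d : ℝ≥0∞) * ENNReal.ofReal M = ENNReal.ofReal (d * M) := by
          rw [ENNReal.ofReal_mul (Nat.cast_nonneg d), ENNReal.ofReal_natCast]
        rw [lintegral_const, markIntensity_univ, h, ← ENNReal.ofReal_mul (by positivity)]

theorem measurableSet_markSet (d : ℕ) (M : ℝ) : MeasurableSet (markSet d M) := by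
  have : markSet d M = ⋂ y, (fun ξ : Vec d => ξ y) ⁻¹' Icc 0 M := by
    ext ξ; simp [markSet]
  rw [this]
  exact MeasurableSet.iInter fun y =>
    ((PiLp.continuous_apply 2 (fun _ : Fin d => ℝ) y).measurable) measurableSet_Icc

/-! ### Left limits -/

/-- The left limit is the eventual value of the path frozen on finer and finer grids, so its level
set is a lower limit of countable unions of cells. -/
theorem measurableSet_leftLim_eq {S : Type*} {φ l : ℝ → S} {T : ℝ}
    (hl : ∀ s ∈ Ioc 0 T, ∀ᶠ r in 𝓝[<] s, φ r = l s) (c : S) :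
    MeasurableSet (Ioc 0 T ∩ {s | l s = c}) := by
  classical
  -- The condition on s holds for every k; it only records that the left endpoint is within one mesh
  -- of each point of the cell.
  let B : ℕ → Set ℝ := fun n => ⋃ k ∈ {k : ℕ | φ (T * k / (n + 1)) = c ∧
      ∀ s ∈ Ioc (T * k / (n + 1)) (T * ((k + 1 : ℕ) : ℝ) / (n + 1)),
        s - T / (n + 1) ≤ T * k / (n + 1)},
    Ioc (T * k / (n + 1)) (T * ((k + 1 : ℕ) : ℝ) / (n + 1))
  have hB : ∀ n, MeasurableSet (B n) := fun n =>
    MeasurableSet.biUnion (to_countable _) fun k _ => measurableSet_Ioc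
  have heq : Ioc 0 T ∩ {s | l s = c} = Ioc 0 T ∩ {s | ∀ᶠ n in atTop, s ∈ B n} := by
    ext s
    refine and_congr_right fun hs => ?_
    obtain ⟨δ, hδ, hδφ⟩ := (mem_nhdsLT_iff_exists_Ioo_subset).1 (hl s hs)
    have hlim : Tendsto (fun n : ℕ => T / ((n : ℝ) + 1)) atTop (𝓝 0) :=
      mod_cast (tendsto_const_div_atTop_nhds_zero_nat T).comp (tendsto_add_atTop_nat 1)
    have hev := hlim.eventually_lt_const (sub_pos.2 (mem_Iio.1 hδ))
    simp only [mem_ofPred_eq]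
    constructor
    · intro hsc
      filter_upwards [hev] with n hn
      obtain ⟨k, -, hk, hk'⟩ := exists_grid_index hs n
      refine mem_biUnion (x := k) ⟨?_, fun s hs => ?_⟩ hk
      · have : φ (T * k / (n + 1)) = l s := hδφ ⟨by linarith, hk.1⟩
        rw [this, hsc]
      · have := hs.2
        push_cast at this
        rw [mul_add, add_div, mul_one] at this
        linarith
    · intro h
      obtain ⟨n, hn, hn'⟩ := (hev.and h).exists
      obtain ⟨k, ⟨hk, hk2⟩, hk'⟩ := mem_iUnion₂.1 hn'
      have := hk2 s hk'
      have h3 : φ (T * k / (n + 1)) = l s := hδφ ⟨by linarith, hk'.1⟩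
      rw [← h3, hk]
  have hlim : {s | ∀ᶠ n in atTop, s ∈ B n} = ⋃ n, ⋂ k ≥ n, B k := by
    ext s
    simp only [mem_ofPred_eq, eventually_atTop, mem_iUnion, mem_iInter]
  rw [heq, hlim]
  exact measurableSet_Ioc.inter (MeasurableSet.iUnion fun n =>
    MeasurableSet.biInter (to_countable _) fun k _ => hB k)

theorem IsCadlag.eventually_eq_leftLim {d : ℕ} {T : ℝ} {φ : ℝ → Fin d} (h : IsCadlag T φ)
    {s : ℝ} (hs : s ∈ Ioc 0 T) : ∀ᶠ r in 𝓝[<] s, φ r = Function.leftLim φ s := by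
  have := tendsto_leftLim_of_tendsto (h.2 s hs)
  exact this.eventually ((isOpen_discrete {Function.leftLim φ s}).mem_nhds (mem_singleton _))

/-! ### Coupling of jump processes driven by the same noise -/

/-- The discrete distance of two states. -/
def mismatch {d : ℕ} (x y : Fin d) : ℝ := if x = y then 0 else 1

theorem mismatch_nonneg {d : ℕ} (x y : Fin d) : 0 ≤ mismatch x y := by
  unfold mismatch; split_ifs <;> norm_num

theorem sum_measureReal_mul_ite {Ω S : Type*} [MeasurableSpace Ω] {P : Measure Ω}
    [IsFiniteMeasure P] [Fintype S] {Z : Ω → S} (hZ : ∀ c, MeasurableSet {ω | Z ω = c})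
    (p : S → Prop) [DecidablePred p] :
    ∑ c, P.real {ω | Z ω = c} * (if p c then 1 else 0) = P.real {ω | p (Z ω)} := by
  have h := sum_measureReal_preimage_singleton (μ := P) (Finset.univ.filter p) (f := Z)
    (fun c _ => hZ c)
  have h2 : Z ⁻¹' ↑(Finset.univ.filter p) = {ω | p (Z ω)} := by ext ω; simp
  rw [h2] at h
  rw [← h, Finset.sum_filter]
  exact Finset.sum_congr rfl fun c _ => by
    split_ifs
    · rw [mul_one]; rfl
    · rw [mul_zero]

/-- Equal states compare rates; unequal states use |jump| ≤ d² and total mass dM, paid for by the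
mismatch. The summand 1 makes the constant strictly positive, as needed for the exponential rate
later. -/
theorem lintegral_abs_jump_sub_le_mismatch {d : ℕ} {M ℓ e : ℝ} (hM : 0 ≤ M) (hℓ : 0 ≤ ℓ)
    (he : 0 ≤ e) {x y : Fin d} {a b : Vec d} (hab : x = y → ∑ z, |a z - b z| ≤ ℓ * e) :
    ∫⁻ ξ, ENNReal.ofReal |jump x ξ a - jump y ξ b| ∂(markIntensity d M)
      ≤ ENNReal.ofReal ((2 * (d * d) * (d * M) + d * ℓ + 1) * (mismatch x y + e)) := by
  have hd : (0 : ℝ) ≤ d := Nat.cast_nonneg d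
  have h1 : 0 ≤ 2 * ((d : ℝ) * d) * (d * M) := by positivity
  have h2 : 0 ≤ (d : ℝ) * ℓ := by positivity
  by_cases hxy : x = y
  · subst hxy
    refine (lintegral_abs_jump_sub_le x a b).trans (ENNReal.ofReal_le_ofReal ?_)
    have := mul_le_mul_of_nonneg_left (hab rfl) hd
    simp only [mismatch, if_true, zero_add]
    nlinarith [mul_nonneg h1 he]
  · refine (lintegral_abs_jump_sub_le_const x y a b).trans (ENNReal.ofReal_le_ofReal ?_)
    simp only [mismatch, if_neg hxy]
    nlinarith [mul_nonneg h1 he, mul_nonneg h2 he]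

/-- Projection of the time line onto `[0, T]`. -/
def clamp (T s : ℝ) : ℝ := max 0 (min s T)

theorem clamp_mem {T : ℝ} (hT : 0 ≤ T) (s : ℝ) : clamp T s ∈ Icc 0 T :=
  ⟨le_max_left _ _, max_le hT (min_le_right _ _)⟩

theorem clamp_of_mem {T s : ℝ} (hs : s ∈ Icc 0 T) : clamp T s = s := by
  rw [clamp, min_eq_left hs.2, max_eq_right hs.1]

theorem continuous_clamp (T : ℝ) : Continuous (clamp T) := by unfold clamp; fun_prop

theorem measurable_jump_clamp {d : ℕ} {T : ℝ} (hT : 0 ≤ T) {a : ℝ → Vec d}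
    (ha : ContinuousOn a (Icc 0 T)) (x : Fin d) :
    Measurable fun p : ℝ × Vec d => jump x p.2 (a (clamp T p.1)) :=
  measurable_jump x measurable_snd
    ((ha.comp_continuous (continuous_clamp T) (clamp_mem hT)).measurable.comp measurable_fst)

/-- Needed to subtract the two stochastic integrals. Measurability comes from splitting over the
finitely many left limits; the jumps are bounded and the realised noise is finite. -/
theorem integrableOn_jump {d N : ℕ} {T t M : ℝ} (hT : 0 ≤ T) (ht : t ≤ T)
    {μ : Measure (ℝ × Vec d)} (hμ : μ univ < ∞) {a : ℝ → (Fin N → Fin d) → Vec d}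
    (ha : ∀ x, ContinuousOn (fun s => a s x) (Icc 0 T)) {l : ℝ → Fin N → Fin d}
    (hl : ∀ c, MeasurableSet (Ioc 0 T ∩ {s | l s = c})) (i : Fin N) :
    IntegrableOn (fun p : ℝ × Vec d => jump (l p.1 i) p.2 (a p.1 (l p.1)))
      (Ioc 0 t ×ˢ markSet d M) μ := by
  classical
  have hmeas : Measurable fun p : ℝ × Vec d => ∑ c : Fin N → Fin d,
      ((Ioc 0 T ∩ {s | l s = c}) ×ˢ univ).indicator
        (fun p => jump (c i) p.2 (a (clamp T p.1) c)) p :=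
    Finset.measurable_sum _ fun c _ =>
      (measurable_jump_clamp hT (ha c) (c i)).indicator ((hl c).prod MeasurableSet.univ)
  have hB : MeasurableSet (Ioc 0 t ×ˢ markSet d M) :=
    measurableSet_Ioc.prod (measurableSet_markSet d M)
  have : IsFiniteMeasure μ := ⟨hμ⟩
  refine Integrable.of_bound ?_ ((d : ℝ) * d) (ae_of_all _ fun p => abs_jump_le _ _ _)
  refine hmeas.aestronglyMeasurable.congr (ae_restrict_of_forall_mem hB ?_)
  rintro ⟨s, ξ⟩ ⟨hs, -⟩
  have hs' : s ∈ Ioc 0 T := ⟨hs.1, hs.2.trans ht⟩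
  simp only
  rw [Finset.sum_eq_single (l s)]
  · rw [indicator_of_mem (show (s, ξ) ∈ (Ioc 0 T ∩ {s' | l s' = l s}) ×ˢ univ from
      ⟨⟨hs', rfl⟩, mem_univ _⟩)]
    simp only [clamp_of_mem (Ioc_subset_Icc_self hs')]
  · intro c _ hc
    exact indicator_of_notMem (fun h => hc h.1.2.symm) _
  · simp

theorem SolvesSDE.measurableSet_leftLim {d N : ℕ} {T M : ℝ} {Ω : Type*} {mΩ : MeasurableSpace Ω}
    {P : Measure Ω} {𝓕 : Filtration ℝ mΩ} {𝒩 : Fin N → Ω → Measure (ℝ × Vec d)}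
    {Z : Fin N → Ω → Fin d} {β : Fin N → ℝ → (Fin N → Fin d) → Vec d}
    {X : Fin N → ℝ → Ω → Fin d} (hX : SolvesSDE T M P 𝓕 𝒩 Z β X) (ω : Ω)
    (c : Fin N → Fin d) :
    MeasurableSet (Ioc 0 T ∩ {s | (fun j => Function.leftLim (fun r => X j r ω) s) = c}) :=
  measurableSet_leftLim_eq (φ := fun r j => X j r ω)
    (fun _ hs => (eventually_all.2 fun j => (hX.cadlag j ω).eventually_eq_leftLim hs).mono
      fun _ hr => funext hr) c

section coupling

variable {d N : ℕ} {T M : ℝ} {Ω : Type*} {mΩ : MeasurableSpace Ω} {P : Measure Ω}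
  [IsProbabilityMeasure P] {𝓕 : Filtration ℝ mΩ} {𝒩 : Fin N → Ω → Measure (ℝ × Vec d)}
  {Z : Fin N → Ω → Fin d} {α β : Fin N → ℝ → (Fin N → Fin d) → Vec d}
  {Y X : Fin N → ℝ → Ω → Fin d}

/-- The distance of two solutions has a measurable majorant, whose mean is controlled by the
probabilities that the solutions differ at earlier times. -/
theorem exists_majorant_abs_label_sub (hT : 0 ≤ T) (hM : 0 ≤ M)
    (hnoise : IsPlayerNoise T M P 𝓕 𝒩)
    (hY : SolvesSDE T M P 𝓕 𝒩 Z α Y) (hX : SolvesSDE T M P 𝓕 𝒩 Z β X)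
    (hα : ∀ i x, ContinuousOn (fun s => α i s x) (Icc 0 T))
    (hβ : ∀ i x, ContinuousOn (fun s => β i s x) (Icc 0 T))
    {ℓ ε : ℝ} (hℓ : 0 ≤ ℓ) (hε : 0 ≤ ε)
    (hrate : ∀ i, ∀ s ∈ Icc 0 T, ∀ x y : Fin N → Fin d, x i = y i →
      ∑ z, |α i s x z - β i s y z| ≤ ℓ * (ε + ε * ∑ j, mismatch (x j) (y j)))
    {t : ℝ} (ht : t ∈ Icc 0 T) (i : Fin N) {b : ℝ → ℝ≥0∞}
    (hb : ∀ r s, 0 ≤ r → r < s → s ≤ t →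
      ENNReal.ofReal ((2 * (d * d) * (d * M) + d * ℓ + 1) *
        (P.real {ω | Y i r ω ≠ X i r ω}
          + (ε + ε * ∑ j, P.real {ω | Y j r ω ≠ X j r ω}))) ≤ b s) :
    ∃ R : Ω → ℝ≥0∞, Measurable R
      ∧ (∀ᵐ ω ∂P, ∀ r ∈ Icc 0 t,
          ENNReal.ofReal |label (Y i r ω) - label (X i r ω)| ≤ R ω)
      ∧ ∫⁻ ω, R ω ∂P ≤ ∫⁻ s in Ioc 0 t, b s := by
  set k : ℝ := 2 * (d * d) * (d * M) + d * ℓ + 1 with hk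
  have hk0 : 0 ≤ k := by positivity
  let S := (Fin N → Fin d) × (Fin N → Fin d)
  let W : ℝ → Ω → S := fun r ω => (fun j => Y j r ω, fun j => X j r ω)
  let Wl : ℝ → Ω → S := fun s ω => (fun j => Function.leftLim (fun r => Y j r ω) s,
    fun j => Function.leftLim (fun r => X j r ω) s)
  let f : S → ℝ × Vec d → ℝ≥0∞ := fun c p =>
    ENNReal.ofReal |jump (c.1 i) p.2 (α i (clamp T p.1) c.1)
      - jump (c.2 i) p.2 (β i (clamp T p.1) c.2)|
  have hf : ∀ c, Measurable (f c) := fun c =>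
    ((measurable_jump_clamp hT (hα i c.1) (c.1 i)).sub
      (measurable_jump_clamp hT (hβ i c.2) (c.2 i))).abs.ennreal_ofReal
  have hW : ∀ t ∈ Icc 0 T, ∀ c, MeasurableSet[𝓕 t] {ω | W t ω = c} := by
    intro t ht c
    have : {ω | W t ω = c} = (⋂ j, Y j t ⁻¹' {c.1 j}) ∩ ⋂ j, X j t ⁻¹' {c.2 j} := by
      ext ω
      simp only [W, mem_ofPred_eq, mem_inter_iff, mem_iInter, mem_preimage, mem_singleton_iff]
      exact ⟨fun h => ⟨congrFun (congrArg Prod.fst h), congrFun (congrArg Prod.snd h)⟩,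
        fun h => Prod.ext (funext h.1) (funext h.2)⟩
    rw [this]
    exact (MeasurableSet.iInter fun j => hY.adapted j t ht (measurableSet_singleton _)).inter
      (MeasurableSet.iInter fun j => hX.adapted j t ht (measurableSet_singleton _))
  have hWl : ∀ ω, ∀ s ∈ Ioc 0 T, ∀ᶠ r in 𝓝[<] s, W r ω = Wl s ω := by
    intro ω s hs
    filter_upwards [eventually_all.2 fun j => (hY.cadlag j ω).eventually_eq_leftLim hs,
      eventually_all.2 fun j => (hX.cadlag j ω).eventually_eq_leftLim hs] with r h1 h2
    exact Prod.ext (funext h1) (funext h2)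
  obtain ⟨R, hRm, hRle, hRint⟩ := exists_lintegral_leftLim_le (T := T)
    (ν := markIntensity d M) (hnoise.poisson i) (𝓕 := 𝓕)
    (fun s hs => indep_of_indep_of_le_right (hnoise.indep_future s hs)
      (le_iSup (fun i => MeasurableSpace.comap
        (fun ω => (𝒩 i ω).restrict (Ioi s ×ˢ univ)) inferInstance) i))
    hW hWl hf ht (b := b) (by
      intro r s hr hrs hst
      have hsT : s ∈ Icc 0 T := ⟨hr.trans hrs.le, hst.trans ht.2⟩
      have hrT : r ∈ Icc 0 T := ⟨hr, hrs.le.trans hsT.2⟩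
      have hWr : ∀ c, MeasurableSet {ω | W r ω = c} := fun c => 𝓕.le _ _ (hW r hrT c)
      refine le_trans ?_ (hb r s hr hrs hst)
      have hsum0 : ∀ c : S, 0 ≤ ε + ε * ∑ j, mismatch (c.1 j) (c.2 j) := fun c =>
        add_nonneg hε (mul_nonneg hε (Finset.sum_nonneg fun j _ => mismatch_nonneg _ _))
      calc ∑ c, P {ω | W r ω = c} * ∫⁻ ξ, f c (s, ξ) ∂(markIntensity d M)
          ≤ ∑ c : S, ENNReal.ofReal (P.real {ω | W r ω = c} * (k *
              (mismatch (c.1 i) (c.2 i) + (ε + ε * ∑ j, mismatch (c.1 j) (c.2 j))))) := by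
            refine Finset.sum_le_sum fun c _ => ?_
            rw [ENNReal.ofReal_mul measureReal_nonneg, ofReal_measureReal]
            gcongr
            simp only [f, clamp_of_mem hsT]
            exact lintegral_abs_jump_sub_le_mismatch hM hℓ (hsum0 c)
              fun hc => hrate i s hsT c.1 c.2 hc
        _ = ENNReal.ofReal (∑ c : S, P.real {ω | W r ω = c} * (k *
              (mismatch (c.1 i) (c.2 i) + (ε + ε * ∑ j, mismatch (c.1 j) (c.2 j))))) :=
            (ENNReal.ofReal_sum_of_nonneg fun c _ => mul_nonneg measureReal_nonneg
              (mul_nonneg hk0 (add_nonneg (mismatch_nonneg _ _) (hsum0 c)))).symm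
        _ ≤ _ := by
            refine ENNReal.ofReal_le_ofReal (le_of_eq ?_)
            have h1 : ∀ j, ∑ c : S, P.real {ω | W r ω = c} * mismatch (c.1 j) (c.2 j)
                = P.real {ω | Y j r ω ≠ X j r ω} := by
              intro j
              rw [← sum_measureReal_mul_ite hWr fun c : S => c.1 j ≠ c.2 j]
              refine Finset.sum_congr rfl fun c _ => ?_
              by_cases hc : c.1 j = c.2 j <;> simp [mismatch, hc]
            have h2 : ∑ c : S, P.real {ω | W r ω = c} = 1 := by
              have := sum_measureReal_mul_ite (P := P) hWr fun _ => True
              simpa using this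
            have h3 : ∀ c : S, P.real {ω | W r ω = c} * (k *
                (mismatch (c.1 i) (c.2 i) + (ε + ε * ∑ j, mismatch (c.1 j) (c.2 j))))
                = k * (P.real {ω | W r ω = c} * mismatch (c.1 i) (c.2 i))
                  + k * ε * P.real {ω | W r ω = c}
                  + k * ε * ∑ j, P.real {ω | W r ω = c} * mismatch (c.1 j) (c.2 j) := by
              intro c
              rw [← Finset.mul_sum]
              ring
            simp only [h3]
            rw [Finset.sum_add_distrib, Finset.sum_add_distrib, ← Finset.mul_sum,
              ← Finset.mul_sum, ← Finset.mul_sum, Finset.sum_comm, h1, h2]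
            simp only [h1]
            ring)
  refine ⟨R, hRm, ?_, hRint⟩
  filter_upwards [hY.equation, hX.equation, (hnoise.poisson i).ae_isFiniteMeasure]
    with ω hYω hXω hfin r hr
  have hrT : r ∈ Icc 0 T := ⟨hr.1, hr.2.trans ht.2⟩
  have hB : MeasurableSet (Ioc 0 r ×ˢ markSet d M) :=
    measurableSet_Ioc.prod (measurableSet_markSet d M)
  -- The common initial state cancels.
  rw [hYω i r hrT, hXω i r hrT, add_sub_add_left_eq_sub,
    ← integral_sub (integrableOn_jump hT hrT.2 hfin (hα i) (hY.measurableSet_leftLim ω) i)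
      (integrableOn_jump hT hrT.2 hfin (hβ i) (hX.measurableSet_leftLim ω) i),
    ← Real.enorm_eq_ofReal_abs]
  refine (enorm_integral_le_lintegral_enorm _).trans (le_trans ?_ (hRle ω))
  -- The absolute integrand is extended from [0, r] to [0, t], so the same R serves all r and no
  -- maximal inequality is needed.
  refine le_trans (setLIntegral_mono' hB ?_) (lintegral_mono_set
    (prod_mono (Ioc_subset_Ioc_right hr.2) (subset_univ _)))
  rintro ⟨s, ξ⟩ ⟨hs, -⟩
  have hs' : s ∈ Icc 0 T := ⟨hs.1.le, hs.2.trans hrT.2⟩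
  simp only [f, Wl, clamp_of_mem hs', Real.enorm_eq_ofReal_abs]
  exact le_rfl

/-- A Gronwall argument: if an exponential bound always improves by a factor `1 / 2`, up to an
error `e`, then it holds with a constant of order `e`. -/
theorem le_of_exp_bound_halves {ι : Type*} {ψ : ι → ℝ → ℝ} {T r e : ℝ} (hr : 0 ≤ r)
    (he : 0 ≤ e) (hψ0 : ∀ j t, 0 ≤ ψ j t) (hψ1 : ∀ j t, ψ j t ≤ 1)
    (h : ∀ m, 0 ≤ m → (∀ j, ∀ t ∈ Icc 0 T, ψ j t ≤ m * Real.exp (r * t)) →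
      ∀ j, ∀ t ∈ Icc 0 T, ψ j t ≤ m * Real.exp (r * t) / 2 + e) :
    ∀ j, ∀ t ∈ Icc 0 T, ψ j t ≤ 2 * e * Real.exp (r * T) := by
  intro j t ht
  -- The supremum of the weighted values is finite because ψ ≤ 1, and the hypothesis applied to it
  -- gives m ≤ m/2 + e. No regularity of ψ in time is required.
  let A : Set ℝ := {y | ∃ j, ∃ t ∈ Icc 0 T, y = ψ j t * Real.exp (-(r * t))}
  have hbdd : BddAbove A := by
    refine ⟨1, ?_⟩
    rintro _ ⟨j, t, ht, rfl⟩
    have h1 : Real.exp (-(r * t)) ≤ 1 :=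
      Real.exp_le_one_iff.2 (neg_nonpos.2 (mul_nonneg hr ht.1))
    exact mul_le_one₀ (hψ1 j t) (Real.exp_pos _).le h1
  have hmem : ∀ j, ∀ t ∈ Icc 0 T, ψ j t * Real.exp (-(r * t)) ≤ sSup A := fun j t ht =>
    le_csSup hbdd ⟨j, t, ht, rfl⟩
  have hm0 : 0 ≤ sSup A :=
    (mul_nonneg (hψ0 j t) (Real.exp_pos _).le).trans (hmem j t ht)
  have hcancel : ∀ t, Real.exp (-(r * t)) * Real.exp (r * t) = 1 := fun t => by
    rw [← Real.exp_add]; simp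
  have hle : ∀ j, ∀ t ∈ Icc 0 T, ψ j t ≤ sSup A * Real.exp (r * t) := fun j t ht => by
    have := mul_le_mul_of_nonneg_right (hmem j t ht) (Real.exp_pos (r * t)).le
    rwa [mul_assoc, hcancel, mul_one] at this
  have hhalf : sSup A ≤ sSup A / 2 + e := by
    refine csSup_le ⟨_, j, t, ht, rfl⟩ ?_
    rintro _ ⟨j, t, ht, rfl⟩
    have h1 := mul_le_mul_of_nonneg_right (h _ hm0 hle j t ht) (Real.exp_pos (-(r * t))).le
    have h2 : Real.exp (-(r * t)) ≤ 1 :=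
      Real.exp_le_one_iff.2 (neg_nonpos.2 (mul_nonneg hr ht.1))
    have h3 : (sSup A * Real.exp (r * t) / 2 + e) * Real.exp (-(r * t))
        = sSup A / 2 * (Real.exp (-(r * t)) * Real.exp (r * t)) + e * Real.exp (-(r * t)) := by
      ring
    rw [h3, hcancel, mul_one] at h1
    nlinarith [mul_le_mul_of_nonneg_left h2 he]
  have h4 : Real.exp (r * t) ≤ Real.exp (r * T) :=
    Real.exp_le_exp.2 (mul_le_mul_of_nonneg_left ht.2 hr)
  calc ψ j t ≤ sSup A * Real.exp (r * t) := hle j t ht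
    _ ≤ 2 * e * Real.exp (r * T) := mul_le_mul (by linarith) h4 (Real.exp_pos _).le (by linarith)

/-- The exponent 6k makes the integral of 3k m e^{6ks} at most m e^{6kt}/2, the halving required by
`le_of_exp_bound_halves`. -/
theorem lintegral_ofReal_exp_le {k m ε t : ℝ} (hk : 0 < k) (hm : 0 ≤ m) (hε : 0 ≤ ε)
    (ht : 0 ≤ t) :
    ∫⁻ s in Ioc 0 t, ENNReal.ofReal (k * (3 * (m * Real.exp (6 * k * s)) + ε))
      ≤ ENNReal.ofReal (m * Real.exp (6 * k * t) / 2 + k * ε * t) := by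
  have hcont : Continuous fun s => k * (3 * (m * Real.exp (6 * k * s)) + ε) := by fun_prop
  have hint : ∫ s in (0)..t, k * (3 * (m * Real.exp (6 * k * s)) + ε)
      = (m * Real.exp (6 * k * t) / 2 + k * ε * t)
        - (m * Real.exp (6 * k * 0) / 2 + k * ε * 0) := by
    refine intervalIntegral.integral_eq_sub_of_hasDerivAt
      (f := fun s => m * Real.exp (6 * k * s) / 2 + k * ε * s) (fun s _ => ?_)
      (hcont.intervalIntegrable _ _)
    have h1 : HasDerivAt (fun s => Real.exp (6 * k * s)) (Real.exp (6 * k * s) * (6 * k)) s := by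
      simpa using ((hasDerivAt_id s).const_mul (6 * k)).exp
    have h2 : HasDerivAt (fun s => k * ε * s) (k * ε) s := by
      simpa using (hasDerivAt_id s).const_mul (k * ε)
    exact (((h1.const_mul m).div_const 2).add h2).congr_deriv (by ring)
  rw [← ofReal_integral_eq_lintegral_ofReal
    ((hcont.integrableOn_Icc (a := 0) (b := t)).mono_set Ioc_subset_Icc_self)
    (ae_of_all _ fun s => by positivity), ← intervalIntegral.integral_of_le ht, hint]
  refine ENNReal.ofReal_le_ofReal ?_
  simp only [mul_zero, Real.exp_zero]
  linarith

/-- Two solutions driven by the same noise, with rates that differ by `O(ε)` where `ε` is of the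
order of `1 / N`, are within `O(ε)` of each other. -/
theorem exists_majorant_le_of_rates (hT : 0 < T) (hM : 0 ≤ M)
    (hnoise : IsPlayerNoise T M P 𝓕 𝒩)
    (hY : SolvesSDE T M P 𝓕 𝒩 Z α Y) (hX : SolvesSDE T M P 𝓕 𝒩 Z β X)
    (hα : ∀ i x, ContinuousOn (fun s => α i s x) (Icc 0 T))
    (hβ : ∀ i x, ContinuousOn (fun s => β i s x) (Icc 0 T))
    {ℓ ε : ℝ} (hℓ : 0 ≤ ℓ) (hε : 0 ≤ ε) (hNε : N * ε ≤ 2)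
    (hrate : ∀ i, ∀ s ∈ Icc 0 T, ∀ x y : Fin N → Fin d, x i = y i →
      ∑ z, |α i s x z - β i s y z| ≤ ℓ * (ε + ε * ∑ j, mismatch (x j) (y j)))
    {k : ℝ} (hk : k = 2 * (d * d) * (d * M) + d * ℓ + 1) (i : Fin N) :
    ∃ R : Ω → ℝ≥0∞, Measurable R
      ∧ (∀ᵐ ω ∂P, ∀ r ∈ Icc 0 T,
          ENNReal.ofReal |label (Y i r ω) - label (X i r ω)| ≤ R ω)
      ∧ ∫⁻ ω, R ω ∂P ≤ ENNReal.ofReal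
          (k * (6 * k * T * Real.exp (6 * k * T) + 1) * T * ε) := by
  have hk0 : 0 < k := by rw [hk]; positivity
  let ψ : Fin N → ℝ → ℝ := fun j r => P.real {ω | Y j r ω ≠ X j r ω}
  -- The 3 is 1 for player i plus 2 for the sum over all players, by Nε ≤ 2.
  have hsum : ∀ {c : ℝ}, 0 ≤ c → ∀ {r}, (∀ j, ψ j r ≤ c) → ∀ i,
      k * (ψ i r + (ε + ε * ∑ j, ψ j r)) ≤ k * (3 * c + ε) := by
    intro c hc r hψ i
    refine mul_le_mul_of_nonneg_left ?_ hk0.le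
    have h1 : ∑ j, ψ j r ≤ N * c := by
      simpa using Finset.sum_le_sum fun j (_ : j ∈ Finset.univ) => hψ j
    have h2 : ε * ∑ j, ψ j r ≤ ε * (N * c) := mul_le_mul_of_nonneg_left h1 hε
    have h3 : ε * (N * c) ≤ 2 * c := by nlinarith
    linarith [hψ i]
  have hψ : ∀ j, ∀ t ∈ Icc 0 T, ψ j t ≤ 2 * (k * ε * T) * Real.exp (6 * k * T) := by
    refine le_of_exp_bound_halves (by positivity) (by positivity)
      (fun _ _ => measureReal_nonneg) (fun _ _ => measureReal_le_one) ?_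
    intro m hm hψm j t ht
    obtain ⟨R, hRm, hRle, hRint⟩ := exists_majorant_abs_label_sub hT.le hM hnoise hY hX hα hβ
      hℓ hε hrate ht j
      (b := fun s => ENNReal.ofReal (k * (3 * (m * Real.exp (6 * k * s)) + ε)))
      (fun r s hr hrs hst => by
        rw [← hk]
        refine ENNReal.ofReal_le_ofReal (hsum (by positivity) (fun j => ?_) j)
        refine (hψm j r ⟨hr, hrs.le.trans (hst.trans ht.2)⟩).trans ?_
        gcongr)
    have hmeas : MeasurableSet {ω | Y j t ω ≠ X j t ω} :=
      (measurableSet_eq_fun ((hY.adapted j t ht).mono (𝓕.le t) le_rfl)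
        ((hX.adapted j t ht).mono (𝓕.le t) le_rfl)).compl
    -- Distinct labels differ by at least 1, so the majorant dominates the mismatch indicator and
    -- the estimate closes on ψ.
    have h1 : P {ω | Y j t ω ≠ X j t ω} ≤ ∫⁻ ω, R ω ∂P := by
      rw [← lintegral_indicator_one hmeas]
      refine lintegral_mono_ae ?_
      filter_upwards [hRle] with ω hω
      by_cases hne : Y j t ω ≠ X j t ω
      · rw [indicator_of_mem (s := {ω | Y j t ω ≠ X j t ω}) hne, Pi.one_apply]
        refine le_trans ?_ (hω t (right_mem_Icc.2 ht.1))
        rw [← ENNReal.ofReal_one]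
        exact ENNReal.ofReal_le_ofReal (one_le_abs_label_sub hne)
      · rw [indicator_of_notMem (s := {ω | Y j t ω ≠ X j t ω}) hne]
        exact zero_le
    have h2 := (h1.trans hRint).trans (lintegral_ofReal_exp_le hk0 hm hε ht.1)
    have h3 : ψ j t ≤ m * Real.exp (6 * k * t) / 2 + k * ε * t :=
      ENNReal.toReal_le_of_le_ofReal
        (add_nonneg (by positivity) (mul_nonneg (by positivity) ht.1)) h2
    have h4 : k * ε * t ≤ k * ε * T := mul_le_mul_of_nonneg_left ht.2 (by positivity)
    linarith
  -- The majorant is constructed once more, on all of [0, T], with the bound on ψ now available.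
  obtain ⟨R, hRm, hRle, hRint⟩ := exists_majorant_abs_label_sub hT.le hM hnoise hY hX hα hβ
    hℓ hε hrate (right_mem_Icc.2 hT.le) i
    (b := fun _ => ENNReal.ofReal (k * (3 * (2 * (k * ε * T) * Real.exp (6 * k * T)) + ε)))
    (fun r s hr hrs hst => by
      rw [← hk]
      exact ENNReal.ofReal_le_ofReal (hsum (by positivity)
        (fun j => hψ j r ⟨hr, hrs.le.trans hst⟩) i))
  refine ⟨R, hRm, hRle, hRint.trans (le_of_eq ?_)⟩
  rw [setLIntegral_const, Real.volume_Ioc, sub_zero, ← ENNReal.ofReal_mul (by positivity)]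
  congr 1
  ring

end coupling

/-! ### Feedback strategies -/

/-- A function of `N` states that varies by at most `c` under a change of any coordinate other
than the `i`-th is Lipschitz in these coordinates. -/
theorem abs_sub_le_mul_sum_mismatch {d N : ℕ} {g : (Fin N → Fin d) → ℝ} {c : ℝ} {i : Fin N}
    (hg : ∀ j, j ≠ i → ∀ x z, |g (Function.update x j z) - g x| ≤ c) {x y : Fin N → Fin d}
    (hi : x i = y i) : |g y - g x| ≤ c * ∑ j, mismatch (x j) (y j) := by
  have key : ∀ s : Finset (Fin N),
      |g (s.piecewise y x) - g x| ≤ c * ∑ j ∈ s, mismatch (x j) (y j) := by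
    intro s
    induction s using Finset.induction_on with
    | empty => simp
    | insert j s hj ih =>
      rw [Finset.piecewise_insert, Finset.sum_insert hj, mul_add]
      have hstep : |g (Function.update (s.piecewise y x) j (y j)) - g (s.piecewise y x)|
          ≤ c * mismatch (x j) (y j) := by
        by_cases h : x j = y j
        · have : Function.update (s.piecewise y x) j (y j) = s.piecewise y x := by
            rw [← h, Function.update_eq_self_iff, Finset.piecewise_eq_of_notMem _ _ _ hj]
          rw [this]
          simp [mismatch, h]
        · rw [mismatch, if_neg h, mul_one]
          exact hg j (fun hji => h (hji ▸ hi)) _ _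
      have := abs_sub_le (g (Function.update (s.piecewise y x) j (y j))) (g (s.piecewise y x)) (g x)
      linarith
  simpa using key Finset.univ

namespace Game

variable {d : ℕ} {𝒢 : Game d}

theorem continuousOn_feedback {K Lα : ℝ} {N : ℕ} (hLα0 : 0 ≤ Lα)
    (hLα : ∀ x p q, ‖p‖ ≤ K → ‖q‖ ≤ K → ‖𝒢.αstar x p - 𝒢.αstar x q‖ ≤ Lα * ‖p - q‖)
    {w : Fin N → ℝ → (Fin N → Fin d) → ℝ}
    (hw : ∀ i x, ContinuousOn (fun t => w i t x) (Icc 0 𝒢.T))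
    (hwK : ∀ i, ∀ t ∈ Icc 0 𝒢.T, ∀ x, ‖playerDiff i (w i t) x‖ ≤ K) (i : Fin N)
    (x : Fin N → Fin d) : ContinuousOn (fun t => 𝒢.feedback w i t x) (Icc 0 𝒢.T) := by
  have h1 : LipschitzOnWith ⟨Lα, hLα0⟩ (𝒢.αstar (x i)) (Metric.closedBall 0 K) :=
    LipschitzOnWith.of_dist_le_mul fun p hp q hq => by
      rw [dist_eq_norm, dist_eq_norm]
      exact hLα _ _ _ (mem_closedBall_zero_iff.1 hp) (mem_closedBall_zero_iff.1 hq)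
  have h2 : ContinuousOn (fun t => playerDiff i (w i t) x) (Icc 0 𝒢.T) :=
    (PiLp.continuous_toLp 2 (fun _ : Fin d => ℝ)).comp_continuousOn
      (continuousOn_pi.2 fun y => (hw i _).sub (hw i x))
  exact h1.continuousOn.comp h2 fun t ht => mem_closedBall_zero_iff.2 (hwK i t ht x)

/-- The hypotheses of the convergence theorem provide the constants of a controlled solution. -/
theorem IsRegularSolution.exists_controlledSolution [Nonempty (Fin d)] {K : ℝ}
    (hK : 𝒢.IsAprioriRadius K) (hH1 : 𝒢.H1 K) {U : ℝ → Fin d → Vec d → ℝ}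
    (hU : 𝒢.IsRegularSolution U) :
    ∃ D B C LH Lα, 𝒢.ControlledSolution U D K B C LH Lα ∧
      ∀ N, 2 ≤ N → ∀ v : Fin N → ℝ → (Fin N → Fin d) → ℝ, 𝒢.SolvesHJB v →
        ∀ t ∈ Icc 0 𝒢.T, ∀ i x, |v i t x| ≤ B := by
  obtain ⟨D, hD, C, hC⟩ := hU
  obtain ⟨cH, cF, cG, hH, hF, hG, hKle⟩ := hK
  choose L hLH hLα using hH1
  have hLle : ∀ x, (L x : ℝ) ≤ ∑ y, (L y : ℝ) := fun x =>
    Finset.single_le_sum (f := fun y => (L y : ℝ)) (fun y _ => (L y).2) (Finset.mem_univ x)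
  have hL0 : 0 ≤ ∑ y, (L y : ℝ) := Finset.sum_nonneg fun y _ => (L y).2
  let x₀ : Fin d := Classical.arbitrary _
  have hcH := (abs_nonneg _).trans (hH x₀)
  have hcF := (abs_nonneg _).trans (hF x₀ _ (diracVec_mem_simplex x₀))
  have hcG := (abs_nonneg _).trans (hG x₀ _ (diracVec_mem_simplex x₀))
  -- B is the a priori bound, for which √d · 2B ≤ K is the definition of the radius. `max C 0`
  -- guards against a negative Lipschitz constant, and the sum over states makes the constants of H
  -- and α* uniform.
  refine ⟨D, 𝒢.T * (cH + cF) + cG, max C 0, ∑ y, (L y : ℝ), ∑ y, (L y : ℝ), ?_, ?_⟩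
  · refine ⟨hD, le_max_right _ _, hL0, hL0, ?_, ?_, ?_, by linarith, ?_, ?_⟩
    · have := 𝒢.T_pos
      positivity
    · exact fun t ht x y m hm m' hm' => (hC t ht x y m hm m' hm').trans
        (mul_le_mul_of_nonneg_right (le_max_left _ _) (norm_nonneg _))
    · exact fun t ht x m hm => hD.abs_value_le hH hF hG ht x hm
    · intro x p q hp hq
      have := (hLH x).dist_le_mul p (mem_closedBall_zero_iff.2 hp) q
        (mem_closedBall_zero_iff.2 hq)
      rw [Real.dist_eq, dist_eq_norm] at this
      exact this.trans (mul_le_mul_of_nonneg_right (hLle x) (norm_nonneg _))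
    · intro x p q hp hq
      have := (hLα x).dist_le_mul p (mem_closedBall_zero_iff.2 hp) q
        (mem_closedBall_zero_iff.2 hq)
      rw [dist_eq_norm, dist_eq_norm] at this
      exact this.trans (mul_le_mul_of_nonneg_right (hLle x) (norm_nonneg _))
  · intro N hN v hv t ht i x
    exact hv.abs_value_le hH (fun i x => hF _ _ (empiricalExcept_mem_simplex hN i x))
      (fun i x => hG _ _ (empiricalExcept_mem_simplex hN i x)) ht i x

namespace ControlledSolution

variable {U : ℝ → Fin d → Vec d → ℝ} {D : ℝ → Fin d → Vec d → Fin d → Vec d}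
  {K B C LH Lα : ℝ} {N : ℕ}

/-- The difference in the own coordinate compares two values of u^{N,i}, each changing by O(1/N) per
opponent that moves. The own state agrees in both configurations, also after the common update. -/
theorem norm_playerDiff_projection_sub_le_mismatch (h : 𝒢.ControlledSolution U D K B C LH Lα)
    (hN : 2 ≤ N) {t : ℝ} (ht : t ∈ Icc 0 𝒢.T) {i : Fin N} {x y : Fin N → Fin d}
    (hxy : x i = y i) :
    ‖playerDiff i (projection N U i t) x - playerDiff i (projection N U i t) y‖
      ≤ Real.sqrt d * (2 * ((2 * B + 6 * C) * ((N : ℝ) - 1)⁻¹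
        * ∑ j, mismatch (x j) (y j))) := by
  set g := projection N U i t with hg
  set c := (2 * B + 6 * C) * ((N : ℝ) - 1)⁻¹ with hc
  have hc0 : 0 ≤ c := mul_nonneg (by linarith [h.B_nonneg, h.C_nonneg]) (inv_pred_pos hN).le
  have hS0 : 0 ≤ ∑ j, mismatch (x j) (y j) := Finset.sum_nonneg fun j _ => mismatch_nonneg _ _
  have hstep : ∀ j, j ≠ i → ∀ x z, |g (Function.update x j z) - g x| ≤ c := fun j hj x z =>
    h.abs_projection_update_sub_le hN ht hj x z
  refine norm_le_sqrt_mul (by positivity) fun z => ?_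
  have h1 := abs_sub_le_mul_sum_mismatch hstep hxy
  have h2 := abs_sub_le_mul_sum_mismatch hstep (x := Function.update x i z)
    (y := Function.update y i z) (by simp)
  have h3 : ∑ j, mismatch (Function.update x i z j) (Function.update y i z j)
      ≤ ∑ j, mismatch (x j) (y j) := by
    refine Finset.sum_le_sum fun j _ => ?_
    by_cases hj : j = i
    · subst hj
      simp [mismatch, hxy]
    · rw [Function.update_of_ne hj, Function.update_of_ne hj]
  have h4 := h2.trans (mul_le_mul_of_nonneg_left h3 hc0)
  rw [PiLp.sub_apply, playerDiff_apply, playerDiff_apply]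
  rw [_root_.abs_le] at h1 h4 ⊢
  constructor <;> linarith [h1.1, h1.2, h4.1, h4.2]

/-- Passing through the projection at x, v is compared with u at one configuration only, and the
change of configuration falls on u. So v need not vary slowly in the opponents' states. -/
theorem sum_abs_feedback_sub_le (h : 𝒢.ControlledSolution U D K B C LH Lα) (hN : 2 ≤ N)
    {v : Fin N → ℝ → (Fin N → Fin d) → ℝ} (hvB : ∀ t ∈ Icc 0 𝒢.T, ∀ i x, |v i t x| ≤ B)
    {c : ℝ} (hc0 : 0 ≤ c)
    (hc : ∀ t ∈ Icc 0 𝒢.T, ∀ i x, |projection N U i t x - v i t x| ≤ c * ((N : ℝ) - 1)⁻¹)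
    (i : Fin N) {t : ℝ} (ht : t ∈ Icc 0 𝒢.T) {x y : Fin N → Fin d} (hxy : x i = y i) :
    ∑ z, |𝒢.feedback v i t x z - 𝒢.feedback (projection N U) i t y z|
      ≤ d * (Lα * (Real.sqrt d * (2 * (c + (2 * B + 6 * C)))))
        * (((N : ℝ) - 1)⁻¹ + ((N : ℝ) - 1)⁻¹ * ∑ j, mismatch (x j) (y j)) := by
  have hLα := h.Lα_nonneg
  have hB := h.B_nonneg
  have hC := h.C_nonneg
  have hε := (inv_pred_pos hN).le
  have hS0 : 0 ≤ ∑ j, mismatch (x j) (y j) := Finset.sum_nonneg fun j _ => mismatch_nonneg _ _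
  have h1 := h.norm_playerDiff_projection_sub_le_mismatch hN ht hxy
  set ε := ((N : ℝ) - 1)⁻¹ with hεdef
  set σ := ∑ j, mismatch (x j) (y j) with hσ
  have h2 : ‖playerDiff i (v i t) x - playerDiff i (projection N U i t) x‖
      ≤ Real.sqrt d * (2 * (c * ε)) := by
    have : playerDiff i (v i t) x - playerDiff i (projection N U i t) x
        = - playerDiff i (fun x => projection N U i t x - v i t x) x := by
      ext z
      simp only [PiLp.sub_apply, PiLp.neg_apply, playerDiff_apply]
      ring
    rw [this, norm_neg]
    exact norm_playerDiff_le (hc t ht i) i x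
  have huB : ∀ x, |projection N U i t x| ≤ B := fun x =>
    h.abs_le t ht _ _ (empiricalExcept_mem_simplex hN i x)
  have h3 : ‖𝒢.feedback v i t x - 𝒢.feedback (projection N U) i t y‖
      ≤ Lα * (Real.sqrt d * (2 * (c + (2 * B + 6 * C)))) * (ε + ε * σ) := by
    rw [feedback, feedback, hxy]
    refine (h.lip_αstar _ _ _ ((norm_playerDiff_le (hvB t ht i) i x).trans h.le_radius)
      ((norm_playerDiff_le huB i y).trans h.le_radius)).trans ?_
    rw [mul_assoc]
    refine mul_le_mul_of_nonneg_left ?_ hLα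
    refine (norm_sub_le_norm_sub_add_norm_sub _ (playerDiff i (projection N U i t) x) _).trans
      ((add_le_add h2 h1).trans ?_)
    rw [← mul_add, mul_assoc (Real.sqrt d)]
    refine mul_le_mul_of_nonneg_left ?_ (Real.sqrt_nonneg _)
    have h5 : 0 ≤ c * (ε * σ) := by positivity
    have h6 : 0 ≤ (2 * B + 6 * C) * ε := by positivity
    linarith
  calc _ ≤ ∑ _z : Fin d, ‖𝒢.feedback v i t x - 𝒢.feedback (projection N U) i t y‖ :=
        Finset.sum_le_sum fun z _ => abs_apply_le_norm _ z
    _ = d * ‖𝒢.feedback v i t x - 𝒢.feedback (projection N U) i t y‖ := by simp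
    _ ≤ _ := by
        rw [mul_assoc]
        exact mul_le_mul_of_nonneg_left h3 (Nat.cast_nonneg d)

end ControlledSolution

end Game

/-! ### Convergence -/

theorem norm_diracVec_sub_le_abs_label {d : ℕ} (x y : Fin d) :
    ‖diracVec x - diracVec y‖ ≤ 2 * |label x - label y| := by
  by_cases h : x = y
  · simp [h]
  · linarith [norm_diracVec_sub_le x y, one_le_abs_label_sub h]

theorem norm_empirical_sub_le {d N : ℕ} (x y : Fin N → Fin d) :
    ‖empirical x - empirical y‖ ≤ ∑ j, 2 * (N : ℝ)⁻¹ * |label (x j) - label (y j)| := by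
  rw [empirical, empirical, ← smul_sub, ← Finset.sum_sub_distrib, norm_smul,
    Real.norm_of_nonneg (by positivity)]
  calc _ ≤ (N : ℝ)⁻¹ * ∑ j, 2 * |label (x j) - label (y j)| := by
        refine mul_le_mul_of_nonneg_left ((norm_sum_le _ _).trans ?_) (by positivity)
        exact Finset.sum_le_sum fun j _ => norm_diracVec_sub_le_abs_label _ _
    _ = _ := by
        rw [Finset.mul_sum]
        exact Finset.sum_congr rfl fun j _ => by ring

theorem inv_pred_le_two_div {N : ℕ} (hN : 2 ≤ N) : ((N : ℝ) - 1)⁻¹ ≤ 2 / N := by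
  have : (2 : ℝ) ≤ N := by exact_mod_cast hN
  rw [inv_eq_one_div, div_le_div_iff₀ (by linarith) (by linarith)]
  linarith

end FiniteMFG

end

open FiniteMFG in
theorem theorem3p3 {d : ℕ} (𝒢 : Game d) (K : ℝ) (hK : 𝒢.IsAprioriRadius K) (hH1 : 𝒢.H1 K)
    (U : ℝ → Fin d → Vec d → ℝ) (hU : 𝒢.IsRegularSolution U) :
    ∃ C : ℝ, 0 < C ∧ ∀ (N : ℕ), 2 ≤ N →
      ∀ (v : Fin N → ℝ → (Fin N → Fin d) → ℝ), 𝒢.SolvesHJB v →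
      ∀ (Ω : Type*) (mΩ : MeasurableSpace Ω) (P : Measure Ω) (_ : IsProbabilityMeasure P)
        (𝓕 : Filtration ℝ mΩ) (𝒩 : Fin N → Ω → Measure (ℝ × Vec d)),
        IsPlayerNoise 𝒢.T 𝒢.M P 𝓕 𝒩 →
      ∀ (m₀ : Vec d), m₀ ∈ simplex d →
      ∀ (Z : Fin N → Ω → Fin d), IsInitialDatum P 𝓕 m₀ Z →
      ∀ (Y X : Fin N → ℝ → Ω → Fin d),
        SolvesSDE 𝒢.T 𝒢.M P 𝓕 𝒩 Z (𝒢.feedback v) Y →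
        SolvesSDE 𝒢.T 𝒢.M P 𝓕 𝒩 Z (𝒢.feedback (projection N U)) X →
        (∀ i, ∫⁻ ω, ⨆ t ∈ Icc 0 𝒢.T,
            ENNReal.ofReal |label (Y i t ω) - label (X i t ω)| ∂P
          ≤ ENNReal.ofReal (C / N)) ∧
        (∫⁻ ω, ⨆ t ∈ Icc 0 𝒢.T,
            ENNReal.ofReal ‖empirical (fun j => Y j t ω) - empirical (fun j => X j t ω)‖ ∂P
          ≤ ENNReal.ofReal (C / N)) ∧
        (∀ i, ∫⁻ ω, ((⨆ t ∈ Icc 0 𝒢.T,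
              ENNReal.ofReal (|projection N U i t (fun j => Y j t ω)
                - v i t (fun j => Y j t ω)| ^ 2))
            + ∫⁻ t in Icc 0 𝒢.T,
              ENNReal.ofReal (‖playerDiff i (projection N U i t) (fun j => Y j t ω)
                - playerDiff i (v i t) (fun j => Y j t ω)‖ ^ 2)) ∂P
          ≤ ENNReal.ofReal (C / N ^ 2)) ∧
        (∀ᵐ ω ∂P, (1 / N : ℝ) * ∑ i, |v i 0 (fun j => Z j ω)
            - projection N U i 0 (fun j => Z j ω)| ≤ C / N) := by
  rcases isEmpty_or_nonempty (Fin d) with hd | hd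
  -- Without states the simplex is empty, so no initial law exists.
  · refine ⟨1, one_pos, fun N _ v _ Ω mΩ P _ 𝓕 𝒩 _ m₀ hm₀ => ?_⟩
    have := hm₀.2
    simp at this
  obtain ⟨D, B, CD, LH, Lα, hS, hvB⟩ := hU.exists_controlledSolution hK hH1
  obtain ⟨c, hc0, hc⟩ := hS.abs_projection_sub_le
  have hT := 𝒢.T_pos
  have hM := 𝒢.M_pos
  have hB0 := hS.B_nonneg
  have hCD0 := hS.C_nonneg
  have hLα0 := hS.Lα_nonneg
  set ℓ : ℝ := d * (Lα * (Real.sqrt d * (2 * (c + (2 * B + 6 * CD))))) with hℓ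
  have hℓ0 : 0 ≤ ℓ := by positivity
  set k : ℝ := 2 * (d * d) * (d * 𝒢.M) + d * ℓ + 1 with hk
  have hk0 : 0 < k := by positivity
  set c₁ : ℝ := k * (6 * k * 𝒢.T * Real.exp (6 * k * 𝒢.T) + 1) * 𝒢.T with hc₁
  have hc₁0 : 0 ≤ c₁ := by positivity
  have hc₂0 : 0 ≤ c ^ 2 * (1 + 4 * d * 𝒢.T) := by positivity
  -- The summands serve the separate estimates: 1/(N-1) ≤ 2/N costs a factor 2, or 4 when squared,
  -- and the empirical measures cost a further 2 because two Dirac masses are at distance at most 2.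
  -- The leading 1 gives positivity.
  refine ⟨1 + 4 * c₁ + 4 * (c ^ 2 * (1 + 4 * d * 𝒢.T)) + 2 * c, by positivity, ?_⟩
  intro N hN v hv Ω mΩ P _ 𝓕 𝒩 hnoise m₀ _ Z _ Y X hY hX
  have hN0 : (0 : ℝ) < N := by exact_mod_cast (by omega : 0 < N)
  have hε0 := (inv_pred_pos hN).le
  have hε2 := inv_pred_le_two_div hN
  have hNε : (N : ℝ) * ((N : ℝ) - 1)⁻¹ ≤ 2 := by
    have := mul_le_mul_of_nonneg_left hε2 hN0.le
    rwa [mul_div_cancel₀ _ hN0.ne'] at this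
  have hvB := hvB N hN v hv
  have hc := hc N hN v hv hvB
  set ε := ((N : ℝ) - 1)⁻¹ with hε
  have huB : ∀ t ∈ Icc 0 𝒢.T, ∀ i x, |projection N U i t x| ≤ B := fun t ht i x =>
    hS.abs_le t ht _ _ (empiricalExcept_mem_simplex hN i x)
  have hmaj := exists_majorant_le_of_rates hT hM.le hnoise hY hX
    (Game.continuousOn_feedback hLα0 hS.lip_αstar
      (fun i x => (hv.contDiffOn_time i x).continuousOn)
      fun i t ht x => (Game.norm_playerDiff_le (hvB t ht i) i x).trans hS.le_radius)
    (Game.continuousOn_feedback hLα0 hS.lip_αstar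
      (fun i x => (hS.sol.contDiffOn_time (x i) _
        (empiricalExcept_mem_simplex hN i x)).continuousOn)
      fun i t ht x => (Game.norm_playerDiff_le (huB t ht i) i x).trans hS.le_radius)
    hℓ0 hε0 hNε
    (fun i s hs x y hxy => hS.sum_abs_feedback_sub_le hN hvB hc0 hc i hs hxy) hk
  choose R hRm hRle hRint using hmaj
  have hdiv : ∀ {a b : ℝ}, 0 ≤ a → 2 * a ≤ b → a * ε ≤ b / N := fun {a b} ha hab =>
    calc a * ε ≤ a * (2 / N) := mul_le_mul_of_nonneg_left hε2 ha
      _ = 2 * a / N := by ring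
      _ ≤ b / N := div_le_div_of_nonneg_right hab hN0.le
  refine ⟨fun i => ?_, ?_, fun i => ?_, ?_⟩
  · calc _ ≤ ∫⁻ ω, R i ω ∂P := by
          refine lintegral_mono_ae ?_
          filter_upwards [hRle i] with ω hω
          exact iSup₂_le hω
      _ ≤ ENNReal.ofReal (c₁ * ε) := hRint i
      _ ≤ _ := ENNReal.ofReal_le_ofReal (hdiv hc₁0 (by linarith))
  · calc _ ≤ ∫⁻ ω, ∑ j, ENNReal.ofReal (2 * (N : ℝ)⁻¹) * R j ω ∂P := by
          refine lintegral_mono_ae ?_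
          filter_upwards [eventually_all.2 hRle] with ω hω
          refine iSup₂_le fun t ht => ?_
          refine (ENNReal.ofReal_le_ofReal (norm_empirical_sub_le _ _)).trans ?_
          rw [ENNReal.ofReal_sum_of_nonneg fun j _ => by positivity]
          refine Finset.sum_le_sum fun j _ => ?_
          rw [ENNReal.ofReal_mul (by positivity)]
          exact mul_le_mul_right (hω j t ht) _
      _ = ∑ j, ENNReal.ofReal (2 * (N : ℝ)⁻¹) * ∫⁻ ω, R j ω ∂P := by
          rw [lintegral_finsetSum _ fun j _ => (hRm j).const_mul _]
          exact Finset.sum_congr rfl fun j _ => lintegral_const_mul _ (hRm j)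
      _ ≤ ∑ _j : Fin N, ENNReal.ofReal (2 * (N : ℝ)⁻¹) * ENNReal.ofReal (c₁ * ε) :=
          Finset.sum_le_sum fun j _ => mul_le_mul_right (hRint j) _
      _ = ENNReal.ofReal (2 * c₁ * ε) := by
          rw [Finset.sum_const, Finset.card_univ, Fintype.card_fin, nsmul_eq_mul,
            ← ENNReal.ofReal_mul (by positivity), ← ENNReal.ofReal_natCast,
            ← ENNReal.ofReal_mul hN0.le]
          congr 1
          field_simp
      _ ≤ _ := ENNReal.ofReal_le_ofReal (hdiv (by positivity) (by linarith))
  · have hsq : ∀ ω, ∀ t ∈ Icc 0 𝒢.T,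
        ENNReal.ofReal (‖playerDiff i (projection N U i t) (fun j => Y j t ω)
          - playerDiff i (v i t) (fun j => Y j t ω)‖ ^ 2)
        ≤ ENNReal.ofReal ((Real.sqrt d * (2 * (c * ε))) ^ 2) := by
      intro ω t ht
      refine ENNReal.ofReal_le_ofReal (pow_le_pow_left₀ (norm_nonneg _) ?_ 2)
      have : ∀ x, playerDiff i (projection N U i t) x - playerDiff i (v i t) x
          = playerDiff i (fun x => projection N U i t x - v i t x) x := by
        intro x
        ext z
        simp only [PiLp.sub_apply, playerDiff_apply]
        ring
      rw [this]
      exact Game.norm_playerDiff_le (hc t ht i) i _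
    -- Both terms are bounded by constants along every path; 4dT comes from (2√d)² over a horizon of
    -- length T.
    calc _ ≤ ∫⁻ _ω, (ENNReal.ofReal ((c * ε) ^ 2)
            + ∫⁻ _t in Icc 0 𝒢.T, ENNReal.ofReal ((Real.sqrt d * (2 * (c * ε))) ^ 2)) ∂P := by
          refine lintegral_mono fun ω => add_le_add (iSup₂_le fun t ht => ?_)
            (setLIntegral_mono' measurableSet_Icc (hsq ω))
          exact ENNReal.ofReal_le_ofReal (pow_le_pow_left₀ (abs_nonneg _) (hc t ht i _) 2)
      _ = ENNReal.ofReal (c ^ 2 * (1 + 4 * d * 𝒢.T) * ε ^ 2) := by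
          rw [lintegral_const, measure_univ, mul_one, setLIntegral_const, Real.volume_Icc,
            ← ENNReal.ofReal_mul (by positivity),
            ← ENNReal.ofReal_add (by positivity) (mul_nonneg (by positivity) (by linarith))]
          congr 1
          rw [mul_pow (Real.sqrt d), Real.sq_sqrt (Nat.cast_nonneg d)]
          ring
      _ ≤ _ := by
          refine ENNReal.ofReal_le_ofReal ?_
          calc c ^ 2 * (1 + 4 * d * 𝒢.T) * ε ^ 2
              ≤ c ^ 2 * (1 + 4 * d * 𝒢.T) * (2 / N) ^ 2 :=
                mul_le_mul_of_nonneg_left (pow_le_pow_left₀ hε0 hε2 2) hc₂0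
            _ = 4 * (c ^ 2 * (1 + 4 * d * 𝒢.T)) / N ^ 2 := by ring
            _ ≤ _ := div_le_div_of_nonneg_right (by linarith) (by positivity)
  · refine ae_of_all _ fun ω => ?_
    calc _ ≤ (1 / N : ℝ) * ∑ _i : Fin N, c * ε := by
          refine mul_le_mul_of_nonneg_left (Finset.sum_le_sum fun i _ => ?_) (by positivity)
          rw [abs_sub_comm]
          exact hc 0 (left_mem_Icc.2 hT.le) i _
      _ = c * ε := by
          rw [Finset.sum_const, Finset.card_univ, Fintype.card_fin, nsmul_eq_mul]
          field_simp
      _ ≤ _ := hdiv hc0 (by linarith)
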